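/- For real parameters let ${}_3F_2\left(\begin{smallmatrix}a_1,a_2,a_3\\ b_1,b_2\end{smallmatrix};1\right)=\sum_{n\ge 0}\frac{(a_1)_n(a_2)_n(a_3)_n}{n!\,(b_1)_n(b_2)_n}$, where $(a)_n=a(a+1)\cdots(a+n-1)$. For $\nu>0$ put $b_n=b_n(\nu)=(n+\nu)(n+\nu+1)$, $n\ge 0$, and let $J_\nu$ be the Jacobi operator in $\ell^2(\mathbb{N}_0)$ (complex sequences) given by $$(J_\nu\phi)_0=b_0\phi_0-b_0\phi_1,\qquad (J_\nu\phi)_n=-b_{n-1}\phi_{n-1}+(b_{n-1}+b_n)\phi_n-b_n\phi_{n+1}\quad(n\ge 1),$$ on the domain of all $\phi\in\ell^2(\mathbb{N}_0)$ for which the right-hand side is again in $\ell^2(\mathbb{N}_0)$. Let $\sigma_{\rm p}(J_\nu)\subset\mathbb{C}$ denote the set of eigenvalues of $J_\nu$. For all $\nu>0$ and $x\ge 0$ the series ${}_3F_2\left(\begin{smallmatrix}x-1/2,\,x+1/2,\,x+3/2\\ 2x+1,\,x+\nu+1/2\end{smallmatrix};1\right)$ converges absolutely, and the following claims hold. 1.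 The function $\nu\mapsto{}_3F_2\left(\begin{smallmatrix}-1/2,\,1/2,\,3/2\\ 1,\,\nu+1/2\end{smallmatrix};1\right)$ has a unique positive zero $\nu_0$, and $\nu_0\in(0,1/2)$. 2. If $\nu\ge\nu_0$, then $\sigma_{\rm p}(J_\nu)=\emptyset$. If $0<\nu<\nu_0$, then the function $x\mapsto{}_3F_2\left(\begin{smallmatrix}x-1/2,\,x+1/2,\,x+3/2\\ 2x+1,\,x+\nu+1/2\end{smallmatrix};1\right)$ has exactly one zero $x_0(\nu)$ in $(0,1/2)$, and $\sigma_{\rm p}(J_\nu)=\{1/4-x_0(\nu)^2\}$. 3. The function $\nu\mapsto x_0(\nu)$ is real analytic and strictly decreasing on $(0,\nu_0)$, and it maps $(0,\nu_0)$ onto $(0,1/2)$. -/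

import Mathlib

noncomputable section

open Set

namespace HilbertL

/-- The Hilbert space `ℓ²(ℕ₀)` of square summable complex sequences. -/
abbrev ell2 : Type := lp (fun _ : ℕ => ℂ) 2

/-- The `n`-th term of the hypergeometric series `₃F₂(a₁, a₂, a₃; b₁, b₂; 1)`; here
`(ascPochhammer ℝ n).eval a` is `(a)ₙ = a (a + 1) ⋯ (a + n - 1)`. -/
def hyp3F2Term (a₁ a₂ a₃ b₁ b₂ : ℝ) (n : ℕ) : ℝ :=
  ((ascPochhammer ℝ n).eval a₁ * (ascPochhammer ℝ n).eval a₂ * (ascPochhammer ℝ n).eval a₃) /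
    ((n.factorial : ℝ) * (ascPochhammer ℝ n).eval b₁ * (ascPochhammer ℝ n).eval b₂)

/-- The unit argument hypergeometric function `₃F₂(a₁, a₂, a₃; b₁, b₂; 1)`. -/
def hyp3F2 (a₁ a₂ a₃ b₁ b₂ : ℝ) : ℝ :=
  ∑' n : ℕ, hyp3F2Term a₁ a₂ a₃ b₁ b₂ n

/-- The sequence `bₙ(ν) = 1 / (1 / (n + ν) - 1 / (n + 1 + ν)) = (n + ν) (n + ν + 1)`. -/
def bSeq (ν : ℝ) (n : ℕ) : ℝ :=
  ((n : ℝ) + ν) * ((n : ℝ) + ν + 1)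

/-- The product of the semi-infinite tridiagonal matrix with diagonal
`b₀, b₀ + b₁, b₁ + b₂, …` and off-diagonals `-b₀, -b₁, …` with the column vector `x`. -/
def jacobiMul (b : ℕ → ℝ) (x : ℕ → ℂ) : ℕ → ℂ
  | 0 => (b 0 : ℂ) * x 0 - (b 0 : ℂ) * x 1
  | n + 1 => -(b n : ℂ) * x n + ((b n : ℂ) + (b (n + 1) : ℂ)) * x (n + 1)
      - (b (n + 1) : ℂ) * x (n + 2)

theorem jacobiMul_add (b : ℕ → ℝ) (x y : ℕ → ℂ) :
    jacobiMul b (x + y) = jacobiMul b x + jacobiMul b y := by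
  funext n
  cases n <;> simp only [jacobiMul, Pi.add_apply] <;> ring

theorem jacobiMul_smul (b : ℕ → ℝ) (c : ℂ) (x : ℕ → ℂ) :
    jacobiMul b (c • x) = c • jacobiMul b x := by
  funext n
  cases n <;> simp only [jacobiMul, Pi.smul_apply, smul_eq_mul] <;> ring

theorem jacobiMul_zero (b : ℕ → ℝ) : jacobiMul b 0 = 0 := by
  funext n
  cases n <;> simp [jacobiMul]

/-- The Jacobi operator in `ℓ²(ℕ₀)` given by the tridiagonal matrix above: it acts by matrix
multiplication on all `x ∈ ℓ²(ℕ₀)` whose image is again square summable. -/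
def jacobiOp (b : ℕ → ℝ) : ell2 →ₗ.[ℂ] ell2 where
  domain :=
    { carrier := {x | Memℓp (jacobiMul b (x : ℕ → ℂ)) 2}
      add_mem' := by
        intro x y hx hy
        simp only [mem_ofPred_eq, lp.coeFn_add] at hx hy ⊢
        rw [jacobiMul_add]
        exact hx.add hy
      zero_mem' := by
        simp only [mem_ofPred_eq, lp.coeFn_zero]
        rw [jacobiMul_zero]
        exact zero_memℓp
      smul_mem' := by
        intro c x hx
        simp only [mem_ofPred_eq, lp.coeFn_smul] at hx ⊢
        rw [jacobiMul_smul]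
        exact hx.const_smul c }
  toFun :=
    { toFun := fun x => ⟨jacobiMul b ((x : ell2) : ℕ → ℂ), x.2⟩
      map_add' := by
        intro x y
        apply Subtype.ext
        exact jacobiMul_add b _ _
      map_smul' := by
        intro c x
        apply Subtype.ext
        exact jacobiMul_smul b c _ }

/-- The Jacobi operator `J_ν`, the inverse of the Hilbert `L`-operator `L_ν`. -/
def J (ν : ℝ) : ell2 →ₗ.[ℂ] ell2 := jacobiOp (bSeq ν)

/-- The point spectrum (set of eigenvalues) of a possibly unbounded operator. -/
def pointSpectrum {H : Type*} [AddCommGroup H] [Module ℂ H] (T : H →ₗ.[ℂ] H) : Set ℂ :=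
  {μ | ∃ x : T.domain, (x : H) ≠ 0 ∧ T x = μ • (x : H)}

end HilbertL

end

noncomputable section

open Filter Topology Polynomial

namespace HilbertL

-- Put y = x + 1/2, so that the spectral parameter is μ = 1/4 - x² = y(1 - y), and the function
-- whose zeros matter is `charFun y ν`. Two contiguous relations (`charFun_add_one`,
-- `charFun_add_one_sub`) say exactly that U = `solU` and V = `solV` solve the eigenvalue recurrence
-- in first-order form, V(n+1) = V(n) + μ U(n), U(n+1) = U(n) - V(n+1)/b(n). The first row of the
-- matrix is the boundary condition V(0) = 0, that is, `charFun y ν = 0`. Since U(n) has size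
-- n^(-y), every zero y in (1/2, 1) yields an eigenvector.
--
-- Conversely, let p be a square summable solution with quasi-difference d. Along a subsequence both
-- √n p(n) and d(n)/√n are small (`frequently_small`). This kills boundary terms at infinity:
-- quadratic quantities that are monotone, or nearly so, exclude nonreal μ, μ ≤ 0 and μ > 1/4. For 0
-- < μ ≤ 1/4 the constant Wronskian of p and U has to vanish, which forces `charFun y ν = 0`; at y =
-- 1/2 the solution U is not square summable.
--
-- It remains to locate the zeros. For fixed y in (0, 1), `charFun` increases strictly in ν, term by
-- term. For fixed ν, Green's identity for two recessive solutions (`charFun_lower_bound`) shows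
-- that `charFun`, once nonnegative at some y ≥ 1/2, is positive at larger y < 1, with a
-- quantitative bound. Hence zeros are unique and have nonzero y-derivative, and the implicit
-- function theorem gives analyticity.

local notation "poch" a:max n:max => Polynomial.eval a (ascPochhammer ℝ n)

/-! ### Pochhammer asymptotics and a summable majorant -/

theorem ascPochhammer_eval_succ_left {R : Type*} [CommSemiring R] (a : R) (n : ℕ) :
    (ascPochhammer R (n + 1)).eval a = a * (ascPochhammer R n).eval (a + 1) := by
  simp [ascPochhammer_succ_left]

theorem ascPochhammer_eval_eq_prod {R : Type*} [CommSemiring R] (a : R) (n : ℕ) :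
    (ascPochhammer R n).eval a = ∏ j ∈ Finset.range n, (a + j) := by
  induction n with
  | zero => simp
  | succ n ih => rw [ascPochhammer_succ_eval, Finset.prod_range_succ, ih]

/-- `(a)ₙ₊₁ / ((n + 1)ᵃ n!)` converges to `1 / Γ(a)`. -/
theorem tendsto_ascPochhammer_div {a : ℝ} (ha : 0 < a) :
    Tendsto (fun n : ℕ => poch a (n + 1) / (((n : ℝ) + 1) ^ a * n.factorial)) atTop
      (𝓝 (Real.Gamma a)⁻¹) := by
  have h1 := (Real.GammaSeq_tendsto_Gamma a).inv₀ (Real.Gamma_pos_of_pos ha).ne'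
  have h2 : Tendsto (fun n : ℕ => ((n : ℝ) / (n + 1)) ^ a) atTop (𝓝 1) := by
    have := (tendsto_natCast_div_add_atTop (1 : ℝ)).rpow_const (p := a) (Or.inl one_ne_zero)
    simpa using this
  have h3 := h1.mul h2
  rw [mul_one] at h3
  refine h3.congr' ?_
  filter_upwards [eventually_gt_atTop 0] with n hn
  have hn' : (0 : ℝ) < n := by exact_mod_cast hn
  rw [Real.GammaSeq, ascPochhammer_eval_eq_prod, Real.div_rpow hn'.le (by positivity)]
  have : (0 : ℝ) < (n : ℝ) ^ a := Real.rpow_pos_of_pos hn' a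
  have : (0 : ℝ) < ((n : ℝ) + 1) ^ a := Real.rpow_pos_of_pos (by positivity) a
  have : ∏ j ∈ Finset.range (n + 1), (a + j) ≠ 0 :=
    Finset.prod_ne_zero_iff.2 fun j _ => by positivity
  field_simp

theorem exists_ascPochhammer_le {a : ℝ} (ha : 0 < a) :
    ∃ C > 0, ∀ n : ℕ, poch a (n + 1) ≤ C * (((n : ℝ) + 1) ^ a * n.factorial) := by
  obtain ⟨C, hC⟩ := (tendsto_ascPochhammer_div ha).bddAbove_range
  refine ⟨max C 1, by positivity, fun n => ?_⟩
  have h := hC ⟨n, rfl⟩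
  dsimp only at h
  rw [div_le_iff₀ (by positivity)] at h
  exact h.trans (by gcongr; exact le_max_left _ _)

theorem exists_le_ascPochhammer {a : ℝ} (ha : 0 < a) :
    ∃ c > 0, ∀ n : ℕ, c * (((n : ℝ) + 1) ^ a * n.factorial) ≤ poch a (n + 1) := by
  have h1 := (tendsto_ascPochhammer_div ha).inv₀ (inv_ne_zero (Real.Gamma_pos_of_pos ha).ne')
  obtain ⟨C, hC⟩ := h1.bddAbove_range
  refine ⟨(max C 1)⁻¹, by positivity, fun n => ?_⟩
  have h := hC ⟨n, rfl⟩
  dsimp only at h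
  have hp : 0 < poch a (n + 1) := ascPochhammer_pos _ _ ha
  rw [inv_div, div_le_iff₀ hp] at h
  rw [inv_mul_le_iff₀ (by positivity)]
  exact h.trans (by gcongr; exact le_max_left _ _)

/-- A majorant for the hypergeometric terms below. -/
def majorant (a p q : ℝ) (n : ℕ) : ℝ :=
  poch a n * poch a (n + 1) * poch (a + 1) (n + 1) /
    ((n + 1).factorial * poch p (n + 1) * poch q (n + 1))

/-- Each (c)ₙ₊₁ is of order (n + 1)^c n!. The parameter a is kept independent of p and q so that the
same bound serves complex parameters, where a bounds a modulus from above and p, q bound real parts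
from below. -/
theorem exists_majorant_le {a p q : ℝ} (ha : 0 < a) (hp : 0 < p) (hq : 0 < q) :
    ∃ C > 0, ∀ n : ℕ, majorant a p q n ≤ C * ((n : ℝ) + 1) ^ (3 * a - p - q - 1) := by
  obtain ⟨C₁, h₁, H₁⟩ := exists_ascPochhammer_le ha
  obtain ⟨C₂, h₂, H₂⟩ := exists_ascPochhammer_le (a := a + 1) (by positivity)
  obtain ⟨C₃, h₃, H₃⟩ := exists_le_ascPochhammer hp
  obtain ⟨C₄, h₄, H₄⟩ := exists_le_ascPochhammer hq
  set K := max 1 a⁻¹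
  have hK : 0 < K := by positivity
  refine ⟨K * C₁ * C₁ * C₂ / (C₃ * C₄), by positivity, fun n => ?_⟩
  have hn : (0 : ℝ) < (n : ℝ) + 1 := by positivity
  have hA : 0 < poch a n := ascPochhammer_pos _ _ ha
  have hA' : 0 < poch a (n + 1) := ascPochhammer_pos _ _ ha
  have hA'' : 0 < poch (a + 1) (n + 1) := ascPochhammer_pos _ _ (by positivity)
  have hP : 0 < poch p (n + 1) := ascPochhammer_pos _ _ hp
  have hQ : 0 < poch q (n + 1) := ascPochhammer_pos _ _ hq
  have hKn : (n : ℝ) + 1 ≤ K * (a + n) := by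
    have h1 : 1 ≤ K := le_max_left _ _
    have h2 : 1 ≤ K * a := by
      calc (1 : ℝ) = a⁻¹ * a := by field_simp
        _ ≤ K * a := by gcongr; exact le_max_right _ _
    have h3 : (n : ℝ) ≤ K * n := by
      have : (0 : ℝ) ≤ n := by positivity
      nlinarith
    linarith
  have h0 : poch a n ≤ K * C₁ * (((n : ℝ) + 1) ^ a * n.factorial) / (n + 1) := by
    rw [le_div_iff₀ hn]
    calc poch a n * (n + 1) ≤ poch a n * (K * (a + n)) := by gcongr
      _ = K * poch a (n + 1) := by rw [ascPochhammer_succ_eval]; ring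
      _ ≤ K * (C₁ * (((n : ℝ) + 1) ^ a * n.factorial)) := by gcongr; exact H₁ n
      _ = _ := by ring
  calc majorant a p q n
      ≤ (K * C₁ * (((n : ℝ) + 1) ^ a * n.factorial) / (n + 1)) *
          (C₁ * (((n : ℝ) + 1) ^ a * n.factorial)) *
          (C₂ * (((n : ℝ) + 1) ^ (a + 1) * n.factorial)) /
        ((n + 1).factorial * (C₃ * (((n : ℝ) + 1) ^ p * n.factorial)) *
          (C₄ * (((n : ℝ) + 1) ^ q * n.factorial))) := by
        unfold majorant
        gcongr
        · exact H₁ n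
        · exact H₂ n
        · exact H₃ n
        · exact H₄ n
    _ = _ := by
        rw [Nat.factorial_succ, show 3 * a - p - q - 1 = a + a + (a + 1) - p - q - 1 - 1 by ring,
          Real.rpow_sub hn, Real.rpow_sub hn, Real.rpow_sub hn, Real.rpow_sub hn,
          Real.rpow_add hn (a + a), Real.rpow_add hn a a, Real.rpow_add hn a 1,
          Real.rpow_one]
        push_cast
        field_simp

theorem majorant_nonneg {a p q : ℝ} (ha : 0 < a) (hp : 0 < p) (hq : 0 < q) (n : ℕ) :
    0 ≤ majorant a p q n := by
  have := ascPochhammer_pos n a ha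
  have := ascPochhammer_pos (n + 1) a ha
  have := ascPochhammer_pos (n + 1) (a + 1) (by positivity)
  have := ascPochhammer_pos (n + 1) p hp
  have := ascPochhammer_pos (n + 1) q hq
  unfold majorant
  positivity

theorem summable_majorant {a p q : ℝ} (ha : 0 < a) (hp : 0 < p) (hq : 0 < q)
    (h : 3 * a < p + q) : Summable (majorant a p q) := by
  obtain ⟨C, -, hC⟩ := exists_majorant_le ha hp hq
  refine Summable.of_nonneg_of_le (majorant_nonneg ha hp hq) hC (Summable.mul_left C ?_)
  have := (summable_nat_add_iff 1).2
    (Real.summable_nat_rpow.2 (show 3 * a - p - q - 1 < -1 by linarith))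
  simpa using this

/-! ### The two hypergeometric functions: convergence, monotonicity and bounds -/

/-- The function `y, s ↦ ₃F₂(y - 1, y, y + 1; 2 y, y + s; 1)`. -/
def charFun (y s : ℝ) : ℝ := hyp3F2 (y - 1) y (y + 1) (2 * y) (y + s)

/-- The function `y, s ↦ ₃F₂(y - 1, y, y; 2 y, y + s; 1)`. -/
def solFun (y s : ℝ) : ℝ := hyp3F2 (y - 1) y y (2 * y) (y + s)

/-- Because (y - 1)ₙ₊₁ = (y - 1)(y)ₙ, all terms after the leading 1 have the sign of y - 1. The
bounds and the monotonicity in s for 0 < y < 1 rest on this. -/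
theorem charFun_term_succ (y s : ℝ) (n : ℕ) :
    hyp3F2Term (y - 1) y (y + 1) (2 * y) (y + s) (n + 1) =
      (y - 1) * majorant y (2 * y) (y + s) n := by
  rw [hyp3F2Term, majorant, ascPochhammer_eval_succ_left (y - 1), sub_add_cancel]
  ring

theorem solFun_term (y s : ℝ) (hy : 0 < y) (n : ℕ) :
    hyp3F2Term (y - 1) y y (2 * y) (y + s) n =
      y / (y + n) * hyp3F2Term (y - 1) y (y + 1) (2 * y) (y + s) n := by
  have h : poch y n * (y + n) = y * poch (y + 1) n := by
    rw [← ascPochhammer_succ_eval, ascPochhammer_eval_succ_left]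
  have h' : poch y n = y / (y + n) * poch (y + 1) n := by
    have : 0 < y + n := by positivity
    field_simp
    linarith
  unfold hyp3F2Term
  nth_rewrite 2 [h']
  ring

theorem summable_charFun_term {y s : ℝ} (hy : 0 < y) (hs : 0 < s) :
    Summable (hyp3F2Term (y - 1) y (y + 1) (2 * y) (y + s)) := by
  rw [← summable_nat_add_iff 1]
  simp_rw [charFun_term_succ]
  exact (summable_majorant hy (by positivity) (by positivity) (by linarith)).mul_left _

theorem summable_solFun_term {y s : ℝ} (hy : 0 < y) (hs : 0 < s) :
    Summable (hyp3F2Term (y - 1) y y (2 * y) (y + s)) := by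
  refine Summable.of_norm_bounded (summable_charFun_term hy hs).norm fun n => ?_
  rw [solFun_term y s hy, norm_mul]
  refine mul_le_of_le_one_left (norm_nonneg _) ?_
  rw [Real.norm_of_nonneg (by positivity)]
  exact div_le_one_of_le₀ (by simp) (by positivity)

theorem hyp3F2Term_zero (a₁ a₂ a₃ b₁ b₂ : ℝ) : hyp3F2Term a₁ a₂ a₃ b₁ b₂ 0 = 1 := by
  simp [hyp3F2Term]

theorem charFun_eq {y s : ℝ} (hy : 0 < y) (hs : 0 < s) :
    charFun y s = 1 - (1 - y) * ∑' n, majorant y (2 * y) (y + s) n := by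
  rw [charFun, hyp3F2, (summable_charFun_term hy hs).tsum_eq_zero_add, hyp3F2Term_zero]
  simp_rw [charFun_term_succ]
  rw [tsum_mul_left]
  ring

theorem charFun_le_one {y s : ℝ} (hy : 0 < y) (hy1 : y ≤ 1) (hs : 0 < s) : charFun y s ≤ 1 := by
  rw [charFun_eq hy hs]
  have : 0 ≤ ∑' n, majorant y (2 * y) (y + s) n :=
    tsum_nonneg (majorant_nonneg hy (by positivity) (by positivity))
  nlinarith

theorem charFun_one {s : ℝ} (hs : 0 < s) : charFun 1 s = 1 := by
  rw [charFun_eq one_pos hs]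
  simp

theorem ascPochhammer_eval_lt {a b : ℝ} (ha : 0 < a) (hab : a < b) (n : ℕ) :
    poch a (n + 1) < poch b (n + 1) := by
  rw [ascPochhammer_eval_eq_prod, ascPochhammer_eval_eq_prod]
  refine Finset.prod_lt_prod_of_nonempty (fun j _ => by positivity) (fun j _ => by linarith) (by simp)

theorem charFun_strictMonoOn {y : ℝ} (hy : 0 < y) (hy1 : y < 1) :
    StrictMonoOn (charFun y) (Set.Ioi 0) := by
  intro s hs t ht hst
  rw [Set.mem_Ioi] at hs ht
  rw [charFun_eq hy hs, charFun_eq hy ht]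
  have key : ∀ n, majorant y (2 * y) (y + t) n < majorant y (2 * y) (y + s) n := fun n => by
    have := ascPochhammer_pos n y hy
    have := ascPochhammer_pos (n + 1) y hy
    have := ascPochhammer_pos (n + 1) (y + 1) (by positivity)
    have := ascPochhammer_pos (n + 1) (2 * y) (by positivity)
    have := ascPochhammer_pos (n + 1) (y + s) (by positivity)
    have := ascPochhammer_eval_lt (a := y + s) (b := y + t) (by positivity) (by linarith) n
    unfold majorant
    gcongr
  have := Summable.tsum_lt_tsum (fun n => (key n).le) (key 0)
    (summable_majorant hy (by positivity) (by positivity) (by linarith))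
    (summable_majorant hy (by positivity) (by positivity) (by linarith))
  nlinarith

theorem solFun_le_one {y s : ℝ} (hy : 0 < y) (hy1 : y ≤ 1) (hs : 0 < s) : solFun y s ≤ 1 := by
  rw [solFun, hyp3F2, (summable_solFun_term hy hs).tsum_eq_zero_add, hyp3F2Term_zero]
  have : ∑' n, hyp3F2Term (y - 1) y y (2 * y) (y + s) (n + 1) ≤ 0 := by
    refine tsum_nonpos fun n => ?_
    rw [solFun_term y s hy, charFun_term_succ]
    refine mul_nonpos_of_nonneg_of_nonpos (by positivity)
      (mul_nonpos_of_nonpos_of_nonneg (by linarith) ?_)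
    exact majorant_nonneg hy (by positivity) (by positivity) n
  linarith

theorem sum_ascPochhammer_div_factorial (y : ℝ) (N : ℕ) :
    ∑ n ∈ Finset.range N, (1 - y) * poch y n / (n + 1).factorial =
      1 - poch y N / N.factorial := by
  induction N with
  | zero => simp
  | succ N ih =>
    rw [Finset.sum_range_succ, ih, ascPochhammer_succ_eval, Nat.factorial_succ]
    push_cast
    have : (N.factorial : ℝ) ≠ 0 := by positivity
    field_simp
    ring

/-- The negated tail is dominated by half of a telescoping series with sum at most 1: the factor 1/2
comes from (y)ₙ₊₁/(2y)ₙ₊₁ ≤ 1/2, while (y)ₙ₊₁/(y + s)ₙ₊₁ ≤ 1. -/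
theorem half_le_solFun {y s : ℝ} (hy : 0 < y) (hy1 : y ≤ 1) (hs : 0 < s) :
    1 / 2 ≤ solFun y s := by
  rw [solFun, hyp3F2, (summable_solFun_term hy hs).tsum_eq_zero_add, hyp3F2Term_zero]
  have hle : ∀ n, -hyp3F2Term (y - 1) y y (2 * y) (y + s) (n + 1) ≤
      1 / 2 * ((1 - y) * poch y n / (n + 1).factorial) := fun n => by
    have h0 := ascPochhammer_pos n y hy
    have h1 := ascPochhammer_pos (n + 1) y hy
    have h2 := ascPochhammer_pos (n + 1) (2 * y) (by positivity)
    have h3 := ascPochhammer_pos (n + 1) (y + s) (by positivity)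
    have h4 := ascPochhammer_eval_lt (a := y) (b := y + s) (by positivity) (by linarith) n
    have h5 : 2 * poch y (n + 1) ≤ poch (2 * y) (n + 1) := by
      rw [ascPochhammer_eval_succ_left, ascPochhammer_eval_succ_left, mul_assoc]
      gcongr
      rw [ascPochhammer_eval_eq_prod, ascPochhammer_eval_eq_prod]
      exact Finset.prod_le_prod (fun j _ => by positivity) (fun j _ => by linarith)
    rw [hyp3F2Term, ascPochhammer_eval_succ_left (y - 1), sub_add_cancel]
    calc -((y - 1) * poch y n * poch y (n + 1) * poch y (n + 1) /
          ((n + 1).factorial * poch (2 * y) (n + 1) * poch (y + s) (n + 1)))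
        = (1 - y) * poch y n / (n + 1).factorial *
          (poch y (n + 1) / poch (2 * y) (n + 1)) *
            (poch y (n + 1) / poch (y + s) (n + 1)) := by field_simp; ring
      _ ≤ (1 - y) * poch y n / (n + 1).factorial * (1 / 2) * 1 := by
          have : 0 ≤ 1 - y := by linarith
          have h6 : poch y (n + 1) / poch (2 * y) (n + 1) ≤ 1 / 2 := by
            rw [div_le_div_iff₀ h2 two_pos]; linarith
          have h7 : poch y (n + 1) / poch (y + s) (n + 1) ≤ 1 := div_le_one_of_le₀ h4.le h3.le
          exact mul_le_mul (mul_le_mul_of_nonneg_left h6 (by positivity)) h7 (by positivity)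
            (by positivity)
      _ = _ := by ring
  have hsum : ∑' n, -hyp3F2Term (y - 1) y y (2 * y) (y + s) (n + 1) ≤ 1 / 2 := by
    refine Summable.tsum_le_of_sum_range_le
      ((summable_nat_add_iff 1).2 (summable_solFun_term hy hs)).neg fun N => ?_
    refine (Finset.sum_le_sum fun n _ => hle n).trans ?_
    rw [← Finset.mul_sum, sum_ascPochhammer_div_factorial]
    have : 0 ≤ poch y N / N.factorial :=
      div_nonneg (ascPochhammer_pos N y hy).le (by positivity)
    linarith
  rw [tsum_neg] at hsum
  linarith

/-- This places ν₀ below 1/2. The value is 1 - (1/2)∑ M(n), and comparison with a telescoping sum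
gives ∑ M(n) ≤ 2 M(0) = 3/2 < 2. -/
theorem charFun_half_half_pos : 0 < charFun (1 / 2) (1 / 2) := by
  rw [charFun_eq (by norm_num) (by norm_num)]
  set M := majorant (1 / 2) (2 * (1 / 2)) (1 / 2 + 1 / 2) with hM
  have hpos : ∀ n, 0 ≤ M n := majorant_nonneg (by norm_num) (by norm_num) (by norm_num)
  have hrec : ∀ n, M (n + 1) * ((n : ℝ) + 2) ^ 3 =
      M n * (((n : ℝ) + 1 / 2) * (n + 3 / 2) * (n + 5 / 2)) := fun n => by
    have h1 : poch (1 : ℝ) (n + 1) ≠ 0 := (ascPochhammer_pos (n + 1) (1 : ℝ) one_pos).ne'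
    simp only [hM, majorant]
    norm_num only
    rw [ascPochhammer_succ_eval (n + 1) (1 / 2 : ℝ), ascPochhammer_succ_eval (n + 1) (3 / 2 : ℝ),
      ascPochhammer_succ_eval (n + 1) (1 : ℝ), Nat.factorial_succ (n + 1)]
    rw [ascPochhammer_succ_eval n (1 / 2 : ℝ)]
    have : ((n + 1).factorial : ℝ) ≠ 0 := by positivity
    push_cast
    have : (n : ℝ) + 2 ≠ 0 := by positivity
    have : (1 : ℝ) + (n + 1) ≠ 0 := by positivity
    field_simp
    ring
  -- Inductive form of M(n) ≤ 2(n + 1)M(n) - 2(n + 2)M(n + 1), which follows from the ratio of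
  -- consecutive terms.
  have hbound : ∀ N, ∑ n ∈ Finset.range N, M n ≤ 2 * M 0 - 2 * ((N : ℝ) + 1) * M N := by
    intro N
    induction N with
    | zero => simp
    | succ N ih =>
      rw [Finset.sum_range_succ]
      have h1 := hpos N
      have h2 : 2 * ((N : ℝ) + 2) * M (N + 1) ≤ (2 * (N + 1) - 1) * M N := by
        have h3 : (0 : ℝ) < ((N : ℝ) + 2) ^ 3 := by positivity
        refine le_of_mul_le_mul_right ?_ h3
        calc 2 * ((N : ℝ) + 2) * M (N + 1) * ((N : ℝ) + 2) ^ 3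
            = 2 * ((N : ℝ) + 2) * (M N * (((N : ℝ) + 1 / 2) * (N + 3 / 2) * (N + 5 / 2))) := by
              rw [← hrec]; ring
          _ ≤ (2 * (N + 1) - 1) * M N * ((N : ℝ) + 2) ^ 3 := by
              have : 0 ≤ M N * ((N : ℝ) ^ 2 + N) := by positivity
              nlinarith
      push_cast
      linarith
  have h0 : M 0 = 3 / 4 := by
    simp only [hM, majorant, zero_add, ascPochhammer_one, ascPochhammer_zero, eval_X, eval_one]
    norm_num
  have : ∑' n, M n ≤ 3 / 2 := by
    refine Summable.tsum_le_of_sum_range_le (summable_majorant (by norm_num) (by norm_num)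
      (by norm_num) (by norm_num)) fun N => (hbound N).trans ?_
    have := hpos N
    rw [h0]
    have : 0 ≤ 2 * ((N : ℝ) + 1) * M N := by positivity
    linarith
  linarith

/-! ### Contiguous relations in s -/

theorem solFun_term_add_one {y s : ℝ} (hy : 0 < y) (hs : 0 < s) (k : ℕ) :
    hyp3F2Term (y - 1) y y (2 * y) (y + (s + 1)) k =
      (y + s) / (y + s + k) * hyp3F2Term (y - 1) y y (2 * y) (y + s) k := by
  have h : poch (y + s) k * (y + s + k) = (y + s) * poch (y + (s + 1)) k := by
    rw [← ascPochhammer_succ_eval, ascPochhammer_eval_succ_left, add_assoc]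
  have h1 := (ascPochhammer_pos k (y + s) (by positivity)).ne'
  have h2 := (ascPochhammer_pos k (y + (s + 1)) (by positivity)).ne'
  have h3 := (ascPochhammer_pos k (2 * y) (by positivity)).ne'
  have h4 : y + s + k ≠ 0 := by positivity
  have h5 : (k.factorial : ℝ) ≠ 0 := by positivity
  have h6 : poch (y + (s + 1)) k = poch (y + s) k * (y + s + k) / (y + s) := by
    have : y + s ≠ 0 := by positivity
    field_simp
    linarith
  unfold hyp3F2Term
  rw [h6]
  have : y + s ≠ 0 := by positivity
  field_simp

theorem charFun_term_eq {y : ℝ} (s : ℝ) (hy : 0 < y) (k : ℕ) :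
    hyp3F2Term (y - 1) y (y + 1) (2 * y) (y + s) k =
      (y + k) / y * hyp3F2Term (y - 1) y y (2 * y) (y + s) k := by
  rw [solFun_term y s hy]
  have : y + k ≠ 0 := by positivity
  field_simp

theorem solFun_term_succ {y s : ℝ} (hy : 0 < y) (hs : 0 < s) (k : ℕ) :
    ((k : ℝ) + 1) * (k + 2 * y) * hyp3F2Term (y - 1) y y (2 * y) (y + s) (k + 1) =
      (y - 1 + k) * (y + k) ^ 2 / (y + s + k) * hyp3F2Term (y - 1) y y (2 * y) (y + s) k := by
  have h1 := (ascPochhammer_pos k (y + s) (by positivity)).ne'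
  have h3 := (ascPochhammer_pos k (2 * y) (by positivity)).ne'
  have h4 : y + s + k ≠ 0 := by positivity
  have h5 : (k.factorial : ℝ) ≠ 0 := by positivity
  have h6 : 2 * y + k ≠ 0 := by positivity
  have h7 : (k : ℝ) + 2 * y ≠ 0 := by positivity
  have h8 : (k : ℝ) + 1 ≠ 0 := by positivity
  unfold hyp3F2Term
  simp only [ascPochhammer_succ_eval, Nat.factorial_succ]
  push_cast
  rw [show (k : ℝ) + 2 * y = 2 * y + k by ring]
  field_simp

theorem charFun_add_one {y s : ℝ} (hy : 0 < y) (hs : 0 < s) :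
    y * charFun y (s + 1) = (s + y) * solFun y s - s * solFun y (s + 1) := by
  unfold charFun solFun hyp3F2
  rw [← tsum_mul_left, ← tsum_mul_left, ← tsum_mul_left, ← Summable.tsum_sub
    ((summable_solFun_term hy hs).mul_left _)
    ((summable_solFun_term hy (show 0 < s + 1 by positivity)).mul_left _)]
  congr 1
  funext k
  rw [charFun_term_eq _ hy, solFun_term_add_one hy hs]
  have h4 : y + s + k ≠ 0 := by positivity
  field_simp
  ring

/-- The boundary term of the telescoping sum in `charFun_add_one_sub`; it is O(k^(-s)). -/
theorem tendsto_mul_solFun_term {y s : ℝ} (hy : 0 < y) (hs : 0 < s) :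
    Tendsto (fun k : ℕ => (k : ℝ) * (k + 2 * y - 1) *
      hyp3F2Term (y - 1) y y (2 * y) (y + s) k) atTop (𝓝 0) := by
  rw [← tendsto_add_atTop_iff_nat 1]
  obtain ⟨C, hC, H⟩ := exists_majorant_le hy (show 0 < 2 * y by positivity)
    (show 0 < y + s by positivity)
  have hlim : Tendsto (fun k : ℕ => (y * |y - 1| * (1 + 2 * y) * C) * ((k : ℝ) + 1) ^ (-s)) atTop
      (𝓝 0) := by
    have h := (tendsto_rpow_neg_atTop hs).comp
      (tendsto_atTop_add_const_right atTop (1 : ℝ) tendsto_natCast_atTop_atTop)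
    simpa using h.const_mul (y * |y - 1| * (1 + 2 * y) * C)
  refine squeeze_zero_norm (fun k => ?_) hlim
  have hk : (0 : ℝ) < (k : ℝ) + 1 := by positivity
  have hm := majorant_nonneg hy (show 0 < 2 * y by positivity) (show 0 < y + s by positivity) k
  rw [solFun_term y s hy, charFun_term_succ, Real.norm_eq_abs]
  push_cast
  have h1 : |((k : ℝ) + 1) * (k + 1 + 2 * y - 1) *
      (y / (y + (k + 1)) * ((y - 1) * majorant y (2 * y) (y + s) k))| =
      y * |y - 1| * ((k + 2 * y) / (y + (k + 1))) * ((k + 1) * majorant y (2 * y) (y + s) k) := by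
    rw [show ((k : ℝ) + 1) * (k + 1 + 2 * y - 1) *
      (y / (y + (k + 1)) * ((y - 1) * majorant y (2 * y) (y + s) k)) =
      (y * ((k + 2 * y) / (y + (k + 1))) * ((k + 1) * majorant y (2 * y) (y + s) k)) * (y - 1) by
        ring, abs_mul, abs_of_nonneg (by positivity)]
    ring
  rw [h1]
  have h2 : ((k : ℝ) + 2 * y) / (y + (k + 1)) ≤ 1 + 2 * y := by
    rw [div_le_iff₀ (by positivity)]
    have : (0 : ℝ) ≤ k := by positivity
    nlinarith [mul_nonneg this hy.le]
  have h3 : ((k : ℝ) + 1) * majorant y (2 * y) (y + s) k ≤ C * ((k : ℝ) + 1) ^ (-s) := by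
    calc ((k : ℝ) + 1) * majorant y (2 * y) (y + s) k
        ≤ (k + 1) * (C * ((k : ℝ) + 1) ^ (3 * y - 2 * y - (y + s) - 1)) := by
          gcongr; exact H k
      _ = C * ((k : ℝ) + 1) ^ (-s) := by
          rw [show 3 * y - 2 * y - (y + s) - 1 = -s - 1 by ring, Real.rpow_sub hk, Real.rpow_one]
          field_simp
  calc y * |y - 1| * ((k + 2 * y) / (y + (k + 1))) * ((k + 1) * majorant y (2 * y) (y + s) k)
      ≤ y * |y - 1| * (1 + 2 * y) * (C * ((k : ℝ) + 1) ^ (-s)) := by gcongr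
    _ = _ := by ring

/-- Unlike `charFun_add_one`, this relation fails term by term: y times the difference of the k-th
terms equals e(k + 1) - e(k) with e(k) = k(k + 2y - 1)g(k), and e tends to 0. -/
theorem charFun_add_one_sub {y s : ℝ} (hy : 0 < y) (hs : 0 < s) :
    s * ((s + 1) / (s + y) * charFun y (s + 1) - charFun y s) = (1 - y) * solFun y s := by
  set g : ℕ → ℝ := hyp3F2Term (y - 1) y y (2 * y) (y + s) with hg
  set e : ℕ → ℝ := fun k => (k : ℝ) * (k + 2 * y - 1) * g k with he
  have h1 := ((summable_charFun_term hy (show 0 < s + 1 by positivity)).hasSum.mul_left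
    ((s + 1) / (s + y))).sub (summable_charFun_term hy hs).hasSum
  have h2 := ((h1.mul_left s).sub ((summable_solFun_term hy hs).hasSum.mul_left (1 - y))).mul_left y
  have h3 := h2.tendsto_sum_nat
  have h4 : ∀ N : ℕ, ∑ k ∈ Finset.range N, y * (s * ((s + 1) / (s + y) *
      hyp3F2Term (y - 1) y (y + 1) (2 * y) (y + (s + 1)) k -
        hyp3F2Term (y - 1) y (y + 1) (2 * y) (y + s) k) -
      (1 - y) * g k) = e N := by
    intro N
    have : e N = e N - e 0 := by simp [he]
    rw [this, ← Finset.sum_range_sub]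
    refine Finset.sum_congr rfl fun k _ => ?_
    have h5 : e (k + 1) = (y - 1 + k) * (y + k) ^ 2 / (y + s + k) * g k := by
      rw [← solFun_term_succ hy hs]
      simp only [he]
      push_cast
      ring
    rw [h5, charFun_term_eq _ hy, charFun_term_eq _ hy, solFun_term_add_one hy hs]
    simp only [he, ← hg]
    have h4 : y + s + k ≠ 0 := by positivity
    field_simp
    ring
  rw [funext h4] at h3
  have h5 := tendsto_nhds_unique h3 (tendsto_mul_solFun_term hy hs)
  have h6 := (mul_eq_zero.1 h5).resolve_left hy.ne'
  have h7 := sub_eq_zero.1 h6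
  exact h7

/-! ### The recessive solution and its size -/

/-- The weight `(ν)ₙ / (ν + y)ₙ`. -/
def weight (ν y : ℝ) (n : ℕ) : ℝ := poch ν n / poch (ν + y) n

theorem weight_zero (ν y : ℝ) : weight ν y 0 = 1 := by simp [weight]

theorem weight_succ (ν y : ℝ) (n : ℕ) :
    weight ν y (n + 1) = weight ν y n * ((ν + n) / (ν + n + y)) := by
  rw [weight, weight, ascPochhammer_succ_eval, ascPochhammer_succ_eval, mul_div_mul_comm]
  ring

theorem weight_pos {ν y : ℝ} (hν : 0 < ν) (hy : 0 < y) (n : ℕ) : 0 < weight ν y n :=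
  div_pos (ascPochhammer_pos _ _ hν) (ascPochhammer_pos _ _ (by positivity))

theorem weight_le {ν y : ℝ} (hν : 0 < ν) (hy : 0 < y) (hy1 : y ≤ 1) (n : ℕ) :
    weight ν y n ≤ ν ^ y * (ν + n) ^ (-y) := by
  induction n with
  | zero =>
    rw [weight_zero, Nat.cast_zero, add_zero, ← Real.rpow_add hν]
    simp
  | succ n ih =>
    rw [weight_succ]
    have hs : 0 < ν + n := by positivity
    set s := ν + n with hsd
    -- Bernoulli's inequality for exponents in (0, 1] is what makes the induction close with the
    -- explicit constant ν^y.
    have h1 : (1 + 1 / s) ^ y ≤ 1 + y * (1 / s) :=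
      rpow_one_add_le_one_add_mul_self (le_trans (by norm_num) (one_div_pos.2 hs).le) hy.le hy1
    have h2 : (s + 1) ^ y = s ^ y * (1 + 1 / s) ^ y := by
      rw [← Real.mul_rpow hs.le (by positivity)]
      congr 1
      field_simp
    have h3 : s ^ (-y) * (s / (s + y)) ≤ (s + 1) ^ (-y) := by
      rw [Real.rpow_neg hs.le, Real.rpow_neg (by positivity), ← div_eq_inv_mul, div_div, h2,
        div_le_iff₀ (by positivity), inv_mul_eq_div, le_div_iff₀ (by positivity)]
      calc s * (s ^ y * (1 + 1 / s) ^ y) ≤ s * (s ^ y * (1 + y * (1 / s))) := by gcongr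
        _ = (s + y) * s ^ y := by field_simp
    calc weight ν y n * (s / (s + y)) ≤ ν ^ y * s ^ (-y) * (s / (s + y)) := by gcongr
      _ = ν ^ y * (s ^ (-y) * (s / (s + y))) := by ring
      _ ≤ ν ^ y * (s + 1) ^ (-y) := by gcongr
      _ = _ := by rw [hsd]; push_cast; ring_nf

theorem exists_le_weight {ν y : ℝ} (hν : 0 < ν) (hy : 0 < y) :
    ∃ c > 0, ∀ n : ℕ, c * ((n : ℝ) + 1) ^ (-y) ≤ weight ν y (n + 1) := by
  obtain ⟨c, hc, H⟩ := exists_le_ascPochhammer hν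
  obtain ⟨C, hC, H'⟩ := exists_ascPochhammer_le (a := ν + y) (by positivity)
  refine ⟨c / C, by positivity, fun n => ?_⟩
  have := ascPochhammer_pos (n + 1) ν hν
  have := ascPochhammer_pos (n + 1) (ν + y) (by positivity)
  have hn : (0 : ℝ) < (n : ℝ) + 1 := by positivity
  rw [weight]
  calc c / C * ((n : ℝ) + 1) ^ (-y)
      = c * (((n : ℝ) + 1) ^ ν * n.factorial) / (C * (((n : ℝ) + 1) ^ (ν + y) * n.factorial)) := by
        rw [Real.rpow_add hn, Real.rpow_neg hn.le]
        field_simp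
    _ ≤ _ := by
        have := H n
        have := H' n
        gcongr

/-- The recessive solution of the eigenvalue recurrence of `J ν` for the parameter
`y * (1 - y)`. -/
def solU (ν y : ℝ) (n : ℕ) : ℝ := weight ν y n * solFun y (ν + n)

/-- The quasi-difference of `solU`. -/
def solV (ν y : ℝ) (n : ℕ) : ℝ := (ν + n) * y * weight ν y n * charFun y (ν + n)

theorem solV_zero (ν y : ℝ) : solV ν y 0 = ν * y * charFun y ν := by
  simp [solV, weight_zero]

theorem solV_succ {ν y : ℝ} (hν : 0 < ν) (hy : 0 < y) (n : ℕ) :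
    solV ν y (n + 1) = solV ν y n + y * (1 - y) * solU ν y n := by
  have h := charFun_add_one_sub hy (show 0 < ν + n by positivity)
  have : ν + n + y ≠ 0 := by positivity
  rw [solU, solV, solV, weight_succ, show y * (1 - y) * (weight ν y n * solFun y (ν + n)) =
    y * weight ν y n * ((1 - y) * solFun y (ν + n)) by ring, ← h]
  push_cast
  rw [← add_assoc]
  field_simp
  ring

theorem solU_succ {ν y : ℝ} (hν : 0 < ν) (hy : 0 < y) (n : ℕ) :
    solU ν y (n + 1) = solU ν y n - solV ν y (n + 1) / bSeq ν n := by
  have h := charFun_add_one hy (show 0 < ν + n by positivity)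
  have h1 : ν + n + y ≠ 0 := by positivity
  have h2 : ν + n ≠ 0 := by positivity
  have h3 : ν + n + 1 ≠ 0 := by positivity
  rw [solU, solU, solV, weight_succ, bSeq]
  push_cast
  rw [← add_assoc, show (ν + n + 1) * y * (weight ν y n * ((ν + n) / (ν + n + y))) *
    charFun y (ν + n + 1) = (ν + n + 1) * (weight ν y n * ((ν + n) / (ν + n + y))) *
    (y * charFun y (ν + n + 1)) by ring, h, show (n : ℝ) + ν = ν + n by ring]
  field_simp
  ring

theorem half_weight_le_solU {ν y : ℝ} (hν : 0 < ν) (hy : 0 < y) (hy1 : y ≤ 1) (n : ℕ) :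
    weight ν y n / 2 ≤ solU ν y n := by
  have := half_le_solFun hy hy1 (show 0 < ν + n by positivity)
  have := weight_pos hν hy n
  rw [solU]
  nlinarith

theorem solU_pos {ν y : ℝ} (hν : 0 < ν) (hy : 0 < y) (hy1 : y ≤ 1) (n : ℕ) : 0 < solU ν y n :=
  (half_pos (weight_pos hν hy n)).trans_le (half_weight_le_solU hν hy hy1 n)

theorem solU_le {ν y : ℝ} (hν : 0 < ν) (hy : 0 < y) (hy1 : y ≤ 1) (n : ℕ) :
    solU ν y n ≤ ν ^ y * (ν + n) ^ (-y) :=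
  (mul_le_of_le_one_right (weight_pos hν hy n).le
    (solFun_le_one hy hy1 (by positivity))).trans (weight_le hν hy hy1 n)

theorem exists_abs_solV_le {ν y : ℝ} (hν : 0 < ν) (hy : 0 < y) (hy1 : y < 1) :
    ∃ C > 0, ∀ n : ℕ, |solV ν y n| ≤ C * (ν + n) ^ (1 - y) := by
  refine ⟨y * ν ^ y * (1 + |charFun y ν|), by positivity, fun n => ?_⟩
  have hs : 0 < ν + n := by positivity
  have h1 : |charFun y (ν + n)| ≤ 1 + |charFun y ν| := by
    have h2 : charFun y ν ≤ charFun y (ν + n) :=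
      (charFun_strictMonoOn hy hy1).monotoneOn hν hs (by simp)
    have h3 := charFun_le_one hy hy1.le hs
    rw [abs_le]
    constructor
    · linarith [neg_abs_le (charFun y ν)]
    · linarith [abs_nonneg (charFun y ν)]
  have h4 := weight_pos hν hy n
  rw [solV, abs_mul, abs_of_pos (show 0 < (ν + n) * y * weight ν y n by positivity)]
  calc (ν + n) * y * weight ν y n * |charFun y (ν + n)|
      ≤ (ν + n) * y * (ν ^ y * (ν + n) ^ (-y)) * (1 + |charFun y ν|) := by
        gcongr
        exact weight_le hν hy hy1.le n
    _ = _ := by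
        rw [sub_eq_add_neg, Real.rpow_add hs, Real.rpow_one]
        ring

/-! ### Sign of the characteristic function -/

/-- In `charFun_add_one_sub`, insert `charFun y (s + 1) ≤ 1` and `solFun y s ≥ 1/2`: the term (1 -
y)/2 then outweighs s(s + 1)/(s + y). -/
theorem charFun_neg_of_small {y s : ℝ} (hy : 0 < y) (hy1 : y < 1) (hs : 0 < s)
    (h : s * (s + 1) < y * (1 - y) / 2) : charFun y s < 0 := by
  have h1 := charFun_add_one_sub hy hs
  have h2 := half_le_solFun hy hy1.le hs
  have h3 := charFun_le_one hy hy1.le (show 0 < s + 1 by positivity)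
  have h4 : (s + 1) / (s + y) * charFun y (s + 1) ≤ (s + 1) / (s + y) :=
    mul_le_of_le_one_right (by positivity) h3
  have h5 : s * ((s + 1) / (s + y)) < (1 - y) / 2 := by
    rw [← mul_div_assoc, div_lt_iff₀ (by positivity)]
    nlinarith
  by_contra! h6
  nlinarith

theorem tendsto_add_natCast_rpow_neg (ν : ℝ) {r : ℝ} (hr : 0 < r) :
    Tendsto (fun n : ℕ => (ν + n) ^ (-r)) atTop (𝓝 0) :=
  (tendsto_rpow_neg_atTop hr).comp
    (tendsto_atTop_add_const_left atTop ν tendsto_natCast_atTop_atTop)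

/-- The product is O(n^(1 - y₁ - y₂)). -/
theorem tendsto_solV_mul_solU {ν y₁ y₂ : ℝ} (hν : 0 < ν) (h₁ : 0 < y₁) (h₁' : y₁ < 1)
    (h₂ : 0 < y₂) (h₂' : y₂ < 1) (h : 1 < y₁ + y₂) :
    Tendsto (fun n => solV ν y₁ n * solU ν y₂ n) atTop (𝓝 0) := by
  obtain ⟨C, hC, H⟩ := exists_abs_solV_le hν h₁ h₁'
  have hlim := (tendsto_add_natCast_rpow_neg ν (show 0 < y₁ + y₂ - 1 by linarith)).const_mul
    (C * ν ^ y₂)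
  rw [mul_zero] at hlim
  refine squeeze_zero_norm (fun n => ?_) hlim
  have hs : 0 < ν + n := by positivity
  rw [norm_mul, Real.norm_eq_abs, Real.norm_of_nonneg (solU_pos hν h₂ h₂'.le n).le]
  calc |solV ν y₁ n| * solU ν y₂ n ≤ C * (ν + n) ^ (1 - y₁) * (ν ^ y₂ * (ν + n) ^ (-y₂)) := by
        gcongr
        · exact (solU_pos hν h₂ h₂'.le n).le
        · exact H n
        · exact solU_le hν h₂ h₂'.le n
    _ = _ := by
        rw [show -(y₁ + y₂ - 1) = (1 - y₁) + -y₂ by ring, Real.rpow_add hs]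
        ring

/-- A quantitative form of the strict monotonicity of the Weyl function. -/
theorem charFun_lower_bound {ν y₁ y₂ : ℝ} (hν : 0 < ν) (h₁ : 1 / 2 ≤ y₁) (h : y₁ < y₂)
    (h₂ : y₂ < 1) (h0 : 0 ≤ charFun y₁ ν) :
    (y₂ - y₁) * (y₁ + y₂ - 1) / (2 * ν) ≤ charFun y₂ ν := by
  have hy₁ : 0 < y₁ := by linarith
  have hy₁' : y₁ < 1 := by linarith
  have hy₂ : 0 < y₂ := by linarith
  -- Green's identity: the Wronskian of the two solutions grows by (μ₁ - μ₂)U₁U₂ > 0 at each step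
  -- and tends to 0, so W(1) ≤ 0. With V₁(0) ≥ 0 this bounds V₂(0) from below.
  set W : ℕ → ℝ := fun n => solV ν y₁ n * solU ν y₂ n - solV ν y₂ n * solU ν y₁ n with hW
  have hb : ∀ n, bSeq ν n ≠ 0 := fun n => by unfold bSeq; positivity
  have hrec : ∀ n, W (n + 1) = W n + (y₂ - y₁) * (y₁ + y₂ - 1) * (solU ν y₁ n * solU ν y₂ n) := by
    intro n
    have := hb n
    simp only [hW]
    rw [solU_succ hν hy₁, solU_succ hν hy₂, solV_succ hν hy₁, solV_succ hν hy₂]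
    field_simp
    ring
  have hU₁ := solU_pos hν hy₁ hy₁'.le
  have hU₂ := solU_pos hν hy₂ h₂.le
  have hc : 0 < (y₂ - y₁) * (y₁ + y₂ - 1) := mul_pos (by linarith) (by linarith)
  have hmono : Monotone W := monotone_nat_of_le_succ fun n => by
    rw [hrec]
    have := mul_pos hc (mul_pos (hU₁ n) (hU₂ n))
    linarith
  have hlim : Tendsto W atTop (𝓝 0) := by
    have h3 := (tendsto_solV_mul_solU hν hy₁ hy₁' hy₂ h₂ (by linarith)).sub
      (tendsto_solV_mul_solU hν hy₂ h₂ hy₁ hy₁' (by linarith))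
    simpa using h3
  have h1 := hmono.ge_of_tendsto hlim 1
  rw [← zero_add 1, hrec] at h1
  simp only [hW, solV_zero] at h1
  have hU : solU ν y₁ 0 * ((y₂ - y₁) * (y₁ + y₂ - 1) * solU ν y₂ 0) ≤
      solU ν y₁ 0 * (ν * y₂ * charFun y₂ ν) := by
    have : 0 ≤ ν * y₁ * charFun y₁ ν * solU ν y₂ 0 :=
      mul_nonneg (by positivity) (hU₂ 0).le
    linarith
  have hU' := le_of_mul_le_mul_left hU (hU₁ 0)
  have h4 := half_weight_le_solU hν hy₂ h₂.le 0
  rw [weight_zero] at h4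
  have h5 : 0 < charFun y₂ ν := by
    have : 0 < (y₂ - y₁) * (y₁ + y₂ - 1) * solU ν y₂ 0 := mul_pos hc (hU₂ 0)
    have : 0 < ν * y₂ := by positivity
    by_contra! h6
    nlinarith
  rw [div_le_iff₀ (by positivity)]
  have : ν * y₂ * charFun y₂ ν ≤ ν * charFun y₂ ν := by
    have : 0 < ν * charFun y₂ ν := by positivity
    nlinarith
  nlinarith

/-! ### Smallness of square summable sequences along subsequences -/

theorem not_summable_of_div_le {f : ℕ → ℝ} {c : ℝ} (hc : 0 < c)
    (h : ∀ᶠ n : ℕ in atTop, c / ((n : ℝ) + 1) ≤ f n) : ¬ Summable f := by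
  intro hf
  have h1 : Summable fun n : ℕ => c / ((n : ℝ) + 1) := by
    refine Summable.of_norm_bounded_eventually_nat hf ?_
    filter_upwards [h] with n hn
    rwa [Real.norm_of_nonneg (by positivity)]
  have h2 : Summable fun n : ℕ => 1 / (((n + 1 : ℕ) : ℝ)) := by
    refine (h1.mul_left c⁻¹).congr fun n => ?_
    push_cast
    field_simp
  exact Real.not_summable_one_div_natCast ((summable_nat_add_iff 1).1 h2)

/-- Cut the partial sum at a fixed N. The head is constant, and Cauchy–Schwarz bounds the squared
remainder by its length times a small tail of ∑ a². -/
theorem tendsto_sq_sum_div {a : ℕ → ℝ} (ha : Summable fun n => a n ^ 2) :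
    Tendsto (fun n : ℕ => (∑ k ∈ Finset.range n, a k) ^ 2 / ((n : ℝ) + 1)) atTop (𝓝 0) := by
  rw [Metric.tendsto_atTop]
  intro ε hε
  obtain ⟨N, hN⟩ := (Metric.tendsto_atTop.1 (tendsto_sum_nat_add fun n => a n ^ 2)) (ε / 4)
    (by positivity)
  set T := (∑ k ∈ Finset.range N, a k) ^ 2
  have h1 : Tendsto (fun n : ℕ => 2 * T / ((n : ℝ) + 1)) atTop (𝓝 0) :=
    tendsto_const_nhds.div_atTop
      (tendsto_atTop_add_const_right atTop (1 : ℝ) tendsto_natCast_atTop_atTop)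
  obtain ⟨M, hM⟩ := Metric.tendsto_atTop.1 h1 (ε / 2) (by positivity)
  refine ⟨max N M, fun n hn => ?_⟩
  have hnN : N ≤ n := (le_max_left _ _).trans hn
  have hM' := hM n ((le_max_right _ _).trans hn)
  have hN' := hN N le_rfl
  rw [Real.dist_0_eq_abs] at hM' hN' ⊢
  have hM'' := (le_abs_self _).trans_lt hM'
  have hN'' := (le_abs_self _).trans_lt hN'
  have hn0 : (0 : ℝ) < (n : ℝ) + 1 := by positivity
  rw [abs_of_nonneg (by positivity)]
  obtain ⟨m, rfl⟩ := Nat.exists_eq_add_of_le hnN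
  have h2 : (∑ k ∈ Finset.range m, a (N + k)) ^ 2 ≤ m * (ε / 4) := by
    refine (sq_sum_le_card_mul_sum_sq (s := Finset.range m) (f := fun k => a (N + k))).trans ?_
    rw [Finset.card_range]
    gcongr
    refine le_trans ?_ hN''.le
    simp_rw [add_comm N]
    exact ((summable_nat_add_iff N).2 ha).sum_le_tsum _ fun k _ => by positivity
  rw [Finset.sum_range_add]
  rw [div_lt_iff₀ hn0] at hM'' ⊢
  have h3 := add_sq_le (a := ∑ k ∈ Finset.range N, a k) (b := ∑ k ∈ Finset.range m, a (N + k))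
  have h4 : (m : ℝ) ≤ ((N + m : ℕ) : ℝ) + 1 := by push_cast; linarith [(N.cast_nonneg : (0:ℝ) ≤ N)]
  nlinarith

/-- If the first quantity stayed above ε, then a² would dominate a harmonic series. The second tends
to 0, so both are small at infinitely many common n. -/
theorem frequently_small {a : ℕ → ℝ} (ha : Summable fun n => a n ^ 2) {ν : ℝ} (hν : 0 < ν)
    {ε : ℝ} (hε : 0 < ε) :
    ∃ᶠ n : ℕ in atTop, (ν + n) * a n ^ 2 < ε ∧
      (∑ k ∈ Finset.range n, a k) ^ 2 / (ν + n) < ε := by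
  have h1 : ∃ᶠ n : ℕ in atTop, (ν + n) * a n ^ 2 < ε := by
    intro h
    refine not_summable_of_div_le (c := ε / (ν + 1)) (by positivity) ?_ ha
    filter_upwards [h] with n hn
    rw [not_lt] at hn
    rw [div_div, div_le_iff₀ (by positivity)]
    refine hn.trans ?_
    rw [mul_comm]
    gcongr
    have : (0 : ℝ) ≤ n := n.cast_nonneg
    nlinarith
  have h2 := tendsto_sq_sum_div ha
  set K := max 1 ν⁻¹
  have hK : 0 < K := by positivity
  have h3 := (tendsto_order.1 h2).2 (ε / K) (by positivity)
  refine (h1.and_eventually h3).mono fun n ⟨h4, h5⟩ => ⟨h4, ?_⟩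
  rw [div_lt_div_iff₀ (by positivity) hK] at h5
  rw [div_lt_iff₀ (by positivity)]
  have h6 : (n : ℝ) + 1 ≤ K * (ν + n) := by
    have h1 : 1 ≤ K := le_max_left _ _
    have h2 : 1 ≤ K * ν := by
      calc (1 : ℝ) = ν⁻¹ * ν := by field_simp
        _ ≤ K * ν := by gcongr; exact le_max_right _ _
    have : (0 : ℝ) ≤ n := n.cast_nonneg
    nlinarith
  have h7 : ε * ((n : ℝ) + 1) ≤ ε * (K * (ν + n)) := by gcongr
  refine lt_of_mul_lt_mul_right (a := K) ?_ hK.le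
  linarith

theorem eq_zero_of_monotone_of_frequently {q : ℕ → ℝ} (hq : Monotone q) (h0 : q 0 = 0)
    (h : ∀ ε > 0, ∃ᶠ n in atTop, q n < ε) (n : ℕ) : q n = 0 := by
  refine le_antisymm ?_ (h0 ▸ hq n.zero_le)
  refine le_of_forall_pos_lt_add fun ε hε => ?_
  obtain ⟨m, hm, hm'⟩ := (frequently_atTop.1 (h ε hε)) n
  linarith [hq hm]

/-! ### Square summable real solutions of the recurrence -/

/-- Real solutions of the eigenvalue equation of `J ν`, together with their
quasi-differences. -/
structure IsSol (ν μ : ℝ) (p d : ℕ → ℝ) : Prop where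
  d_zero : d 0 = 0
  d_succ : ∀ n, d (n + 1) = d n + μ * p n
  p_succ : ∀ n, p (n + 1) = p n - d (n + 1) / bSeq ν n

theorem bSeq_pos {ν : ℝ} (hν : 0 < ν) (n : ℕ) : 0 < bSeq ν n := by
  unfold bSeq
  positivity

namespace IsSol

variable {ν μ : ℝ} {p d : ℕ → ℝ}

theorem d_eq (h : IsSol ν μ p d) (n : ℕ) : d n = μ * ∑ k ∈ Finset.range n, p k := by
  induction n with
  | zero => simp [h.d_zero]
  | succ n ih => rw [h.d_succ, ih, Finset.sum_range_succ]; ring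

theorem frequently_small (h : IsSol ν μ p d) (hν : 0 < ν) (hp : Summable fun n => p n ^ 2)
    {ε : ℝ} (hε : 0 < ε) :
    ∃ᶠ n : ℕ in atTop, (ν + n) * p n ^ 2 < ε ∧ d n ^ 2 / (ν + n) < ε := by
  have hK : 0 < max 1 (μ ^ 2) := by positivity
  refine (HilbertL.frequently_small hp hν (show 0 < ε / max 1 (μ ^ 2) by positivity)).mono
    fun n ⟨h1, h2⟩ => ⟨h1.trans_le (div_le_self hε.le (le_max_left _ _)), ?_⟩
  rw [lt_div_iff₀ hK] at h2
  refine lt_of_le_of_lt ?_ h2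
  rw [h.d_eq, mul_pow, mul_div_assoc, mul_comm]
  gcongr
  exact le_max_right _ _

theorem eq_zero_of_p_zero (h : IsSol ν μ p d) (h0 : p 0 = 0) (n : ℕ) : p n = 0 ∧ d n = 0 := by
  induction n with
  | zero => exact ⟨h0, h.d_zero⟩
  | succ n ih =>
    have h1 : d (n + 1) = 0 := by rw [h.d_succ, ih.1, ih.2]; ring
    exact ⟨by rw [h.p_succ, h1, ih.1]; ring, h1⟩

/-- For μ ≤ 0 the quantity -p d starts at 0, is nondecreasing, and is small infinitely often, so it
vanishes identically. Then d = 0, and p is constant and square summable. -/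
theorem eq_zero_of_nonpos (h : IsSol ν μ p d) (hν : 0 < ν) (hp : Summable fun n => p n ^ 2)
    (hμ : μ ≤ 0) (n : ℕ) : p n = 0 := by
  have hrec : ∀ n, -(p (n + 1) * d (n + 1)) =
      -(p n * d n) + (-μ * p n ^ 2 + d (n + 1) ^ 2 / bSeq ν n) := fun n => by
    have h1 : d n = d (n + 1) - μ * p n := by rw [h.d_succ]; ring
    rw [h.p_succ, h1]
    ring
  have hq := eq_zero_of_monotone_of_frequently (q := fun n => -(p n * d n))
    (monotone_nat_of_le_succ fun n => by
      rw [hrec]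
      have h1 : 0 ≤ -μ * p n ^ 2 := mul_nonneg (by linarith) (sq_nonneg _)
      have h2 : 0 ≤ d (n + 1) ^ 2 / bSeq ν n := div_nonneg (sq_nonneg _) (bSeq_pos hν n).le
      linarith) (by simp [h.d_zero])
    fun ε hε => (h.frequently_small hν hp hε).mono fun n ⟨h1, h2⟩ => by
      have hs : 0 < ν + n := by positivity
      rw [div_lt_iff₀ hs] at h2
      refine (le_abs_self _).trans_lt (abs_lt_of_sq_lt_sq ?_ hε.le)
      have h3 : (ν + n) * (-(p n * d n)) ^ 2 < (ν + n) * ε ^ 2 := by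
        calc (ν + n) * (-(p n * d n)) ^ 2 = (ν + n) * p n ^ 2 * d n ^ 2 := by ring
          _ ≤ ε * d n ^ 2 := by gcongr
          _ < ε * (ε * (ν + n)) := by gcongr
          _ = _ := by ring
      exact lt_of_mul_lt_mul_left h3 hs.le
  have hd : ∀ n, d (n + 1) = 0 := fun n => by
    have h1 := hrec n
    have h2 := hq n
    have h3 := hq (n + 1)
    rw [h2, h3] at h1
    have h4 : 0 ≤ -μ * p n ^ 2 := mul_nonneg (by linarith) (sq_nonneg _)
    have h5 : 0 ≤ d (n + 1) ^ 2 / bSeq ν n := div_nonneg (sq_nonneg _) (bSeq_pos hν n).le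
    have h6 : d (n + 1) ^ 2 / bSeq ν n = 0 := by linarith
    rw [div_eq_zero_iff, sq_eq_zero_iff] at h6
    exact h6.resolve_right (bSeq_pos hν n).ne'
  have hc : ∀ n, p n = p 0 := fun n => by
    induction n with
    | zero => rfl
    | succ n ih => rw [h.p_succ, hd, ih]; simp
  have h1 := hp.tendsto_atTop_zero
  simp_rw [hc] at h1
  rw [hc]
  exact sq_eq_zero_iff.1 (tendsto_nhds_unique tendsto_const_nhds h1)

/-- The energy functional `d² / s - p d + μ s p²` of a solution, where `s = ν + n`, is conserved
up to terms of second order. -/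
theorem energy_succ (h : IsSol ν μ p d) (hν : 0 < ν) (n : ℕ) :
    d (n + 1) ^ 2 / (ν + n + 1) - p (n + 1) * d (n + 1) + μ * (ν + n + 1) * p (n + 1) ^ 2 =
      d n ^ 2 / (ν + n) - p n * d n + μ * (ν + n) * p n ^ 2 +
        (μ * d (n + 1) ^ 2 / ((ν + n) ^ 2 * (ν + n + 1)) - μ ^ 2 * p n ^ 2 / (ν + n)) := by
  have h1 : d n = d (n + 1) - μ * p n := by rw [h.d_succ]; ring
  have : ν + n ≠ 0 := by positivity
  have : ν + n + 1 ≠ 0 := by positivity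
  rw [h.p_succ, h1, bSeq, add_comm (n : ℝ) ν]
  field_simp
  ring

theorem eq_zero_of_quarter_lt (h : IsSol ν μ p d) (hν : 0 < ν) (hp : Summable fun n => p n ^ 2)
    (hμ : 1 / 4 < μ) (n : ℕ) : p n = 0 := by
  set E : ℕ → ℝ := fun n => d n ^ 2 / (ν + n) - p n * d n + μ * (ν + n) * p n ^ 2 with hE
  have hEp : ∀ n, (μ - 1 / 4) * ((ν + n) * p n ^ 2) ≤ E n := fun n => by
    have hs : 0 < ν + n := by positivity
    -- Completing the square: the energy is positive definite precisely because μ > 1/4.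
    have h1 : E n = (d n - (ν + n) * p n / 2) ^ 2 / (ν + n) +
        (μ - 1 / 4) * ((ν + n) * p n ^ 2) := by
      simp only [hE]
      field_simp
      ring
    rw [h1]
    have : 0 ≤ (d n - (ν + n) * p n / 2) ^ 2 / (ν + n) := by positivity
    linarith
  have hμ' : 0 < μ - 1 / 4 := by linarith
  have hE0 : ∀ n, 0 ≤ E n := fun n => le_trans (by positivity) (hEp n)
  set K := μ ^ 2 / (μ - 1 / 4) with hK
  have hK0 : 0 < K := by positivity
  have hKμ : K * (μ - 1 / 4) = μ ^ 2 := div_mul_cancel₀ _ hμ'.ne'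
  have hrec : ∀ n, E n * (1 - K / (ν + n) ^ 2) ≤ E (n + 1) := fun n => by
    have hs : 0 < ν + n := by positivity
    have h1 : E (n + 1) = E n +
        (μ * d (n + 1) ^ 2 / ((ν + n) ^ 2 * (ν + n + 1)) - μ ^ 2 * p n ^ 2 / (ν + n)) := by
      simp only [hE]
      rw [← h.energy_succ hν]
      push_cast
      rw [← add_assoc]
    have h2 : 0 ≤ μ * d (n + 1) ^ 2 / ((ν + n) ^ 2 * (ν + n + 1)) := by positivity
    have h3 : μ ^ 2 * p n ^ 2 / (ν + n) ≤ K / (ν + n) ^ 2 * E n := by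
      calc μ ^ 2 * p n ^ 2 / (ν + n) =
          K / (ν + n) ^ 2 * ((μ - 1 / 4) * ((ν + n) * p n ^ 2)) := by
            rw [← hKμ]; field_simp
        _ ≤ _ := by gcongr; exact hEp n
    rw [h1]
    linarith
  obtain ⟨N, hN⟩ := exists_nat_ge (max 1 (4 * K))
  have hsN : ∀ n, N ≤ n → 1 ≤ ν + n ∧ 4 * K ≤ ν + n := fun n hn => by
    have h1 : (N : ℝ) ≤ n := by exact_mod_cast hn
    exact ⟨by linarith [le_max_left 1 (4 * K)], by linarith [le_max_right 1 (4 * K)]⟩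
  -- The energy may shrink by the factor 1 - K/s² per step; the weight 1 - 2K/s compensates for
  -- this, so H is nondecreasing from N on, where s ≥ max(1, 4K).
  set H : ℕ → ℝ := fun n => (1 - 2 * K / (ν + n)) * E n with hH
  have hg : ∀ n, N ≤ n → 1 / 2 ≤ 1 - 2 * K / (ν + n) := fun n hn => by
    have : 2 * K / (ν + n) ≤ 1 / 2 := by
      rw [div_le_iff₀ (by positivity)]
      linarith [(hsN n hn).2]
    linarith
  have hmono : ∀ n, N ≤ n → H n ≤ H (n + 1) := fun n hn => by
    have h1 := (hsN n hn).1
    have h2 := hg (n + 1) (by omega)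
    push_cast at h2
    set s := ν + n with hs
    rw [← add_assoc, ← hs] at h2
    have hs0 : 0 < s := by positivity
    have h3 : 1 - 2 * K / s ≤ (1 - 2 * K / (s + 1)) * (1 - K / s ^ 2) := by
      have h4 : 0 < s ^ 3 * (s + 1) := by positivity
      rw [← sub_nonneg]
      have h5 : (1 - 2 * K / (s + 1)) * (1 - K / s ^ 2) - (1 - 2 * K / s) =
          K * (s * (s - 1) + 2 * K * s) / (s ^ 3 * (s + 1)) := by
        field_simp
        ring
      rw [h5]
      have : 0 ≤ s - 1 := by linarith
      positivity
    calc H n ≤ (1 - 2 * K / (s + 1)) * (1 - K / s ^ 2) * E n := by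
          simp only [hH]
          exact mul_le_mul_of_nonneg_right h3 (hE0 n)
      _ = (1 - 2 * K / (s + 1)) * (E n * (1 - K / s ^ 2)) := by ring
      _ ≤ (1 - 2 * K / (s + 1)) * E (n + 1) :=
          mul_le_mul_of_nonneg_left (hrec n) (by linarith)
      _ = H (n + 1) := by simp only [hH, hs]; push_cast; rw [← add_assoc]
  have hsmall : ∀ ε > 0, ∃ᶠ n in atTop, E n < ε := fun ε hε => by
    refine (h.frequently_small hν hp (show 0 < ε / (μ + 2) by positivity)).mono
      fun n ⟨h1, h2⟩ => ?_
    have hs : 0 < ν + n := by positivity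
    have h3 : -(p n * d n) ≤ ((ν + n) * p n ^ 2 + d n ^ 2 / (ν + n)) / 2 := by
      have h4 : ((ν + n) * p n ^ 2 + d n ^ 2 / (ν + n)) / 2 + p n * d n =
          ((ν + n) * p n + d n) ^ 2 / (2 * (ν + n)) := by
        field_simp
        ring
      have : 0 ≤ ((ν + n) * p n + d n) ^ 2 / (2 * (ν + n)) := by positivity
      linarith
    have h5 : ε = (ε / (μ + 2)) * (μ + 2) := by field_simp
    have h6 : μ * ((ν + n) * p n ^ 2) < μ * (ε / (μ + 2)) := by gcongr
    simp only [hE]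
    rw [h5]
    linarith
  have hEN : E N = 0 := by
    refine le_antisymm ?_ (hE0 N)
    have hHN : H N ≤ 0 := by
      refine le_of_forall_pos_lt_add fun ε hε => ?_
      obtain ⟨m, hm, hm'⟩ := (frequently_atTop.1 (hsmall ε hε)) N
      have h1 : H N ≤ H m := Nat.le_induction le_rfl (fun k hk ih => ih.trans (hmono k hk)) m hm
      have h2 : H m ≤ E m := by
        refine mul_le_of_le_one_left (hE0 m) ?_
        have : 0 ≤ 2 * K / (ν + m) := by positivity
        linarith
      linarith
    have h1 := hg N le_rfl
    by_contra! h2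
    have : 0 < H N := mul_pos (by linarith) h2
    linarith
  have hpN : p N = 0 := by
    have h1 := hEp N
    rw [hEN] at h1
    by_contra h2
    have : 0 < (μ - 1 / 4) * ((ν + N) * p N ^ 2) := by positivity
    linarith
  have hdN : d N = 0 := by
    have h1 := hEN
    simp only [hE, hpN] at h1
    have h2 : d N ^ 2 / (ν + N) = 0 := by linarith
    rw [div_eq_zero_iff, sq_eq_zero_iff] at h2
    exact h2.resolve_right (by positivity)
  -- The recurrence also runs backwards, so a zero pair at N propagates down to index 0.
  have hback : ∀ m, p m = 0 ∧ d m = 0 → p 0 = 0 := fun m => by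
    induction m with
    | zero => exact fun h => h.1
    | succ m ih =>
      rintro ⟨h1, h2⟩
      have h3 := h.p_succ m
      rw [h1, h2, zero_div, sub_zero] at h3
      have h4 := h.d_succ m
      rw [h2, ← h3, mul_zero, add_zero] at h4
      exact ih ⟨h3.symm, h4.symm⟩
  exact (h.eq_zero_of_p_zero (hback N ⟨hpN, hdN⟩) n).1

theorem wronskian {y : ℝ} (h : IsSol ν (y * (1 - y)) p d) (hν : 0 < ν) (hy : 0 < y) (n : ℕ) :
    p n * solV ν y n - solU ν y n * d n = p 0 * solV ν y 0 := by
  induction n with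
  | zero => rw [h.d_zero]; ring
  | succ n ih =>
    rw [← ih, h.p_succ, solU_succ hν hy, h.d_succ, solV_succ hν hy]
    ring

/-- For y ≥ 1/2, V = O(√n) and U = O(1/√n), while √n p(n) and d(n)/√n are arbitrarily small along a
subsequence. The constant Wronskian is therefore smaller than any ε. -/
theorem wronskian_eq_zero {y : ℝ} (h : IsSol ν (y * (1 - y)) p d) (hν : 0 < ν)
    (hp : Summable fun n => p n ^ 2) (hy : 1 / 2 ≤ y) (hy1 : y < 1) :
    p 0 * solV ν y 0 = 0 := by
  have hy0 : 0 < y := by linarith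
  obtain ⟨C, hC, H⟩ := exists_abs_solV_le hν hy0 hy1
  set A := ν ^ (1 / 2 - y)
  have hA : 0 < A := by positivity
  set B := ν ^ y
  have hB : 0 < B := by positivity
  have hAs : ∀ n : ℕ, (ν + n) ^ (1 / 2 - y) ≤ A := fun n =>
    Real.rpow_le_rpow_of_nonpos hν (by simp) (by linarith)
  rw [← abs_nonpos_iff]
  refine le_of_forall_pos_lt_add fun ε hε => ?_
  set δ := ε / (A * (B + C)) with hδ
  have hδ0 : 0 < δ := by positivity
  obtain ⟨n, h1, h2⟩ := (h.frequently_small hν hp (show 0 < δ ^ 2 by positivity)).exists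
  have hs : 0 < ν + n := by positivity
  set r := (ν + n) ^ (1 / 2 : ℝ) with hr
  have hr0 : 0 < r := by positivity
  have hr2 : r ^ 2 = ν + n := by
    rw [hr, ← Real.rpow_natCast, ← Real.rpow_mul hs.le]
    norm_num
  have h3 : |p n| * r < δ := by
    refine lt_of_pow_lt_pow_left₀ 2 hδ0.le ?_
    rw [mul_pow, sq_abs, hr2]
    linarith
  have h4 : |d n| < δ * r := by
    refine lt_of_pow_lt_pow_left₀ 2 (by positivity) ?_
    rw [mul_pow, sq_abs, hr2]
    rwa [div_lt_iff₀ hs] at h2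
  have h5 : |solV ν y n| ≤ C * (A * r) := by
    refine (H n).trans ?_
    gcongr
    rw [show 1 - y = (1 / 2 - y) + 1 / 2 by ring, Real.rpow_add hs]
    gcongr
    exact hAs n
  have h6 : solU ν y n * r ≤ B * A := by
    calc solU ν y n * r ≤ B * (ν + n) ^ (-y) * r := by
          gcongr
          exact solU_le hν hy0 hy1.le n
      _ = B * (ν + n) ^ (1 / 2 - y) := by
          rw [show 1 / 2 - y = -y + 1 / 2 by ring, Real.rpow_add hs]
          ring
      _ ≤ B * A := by gcongr; exact hAs n
  have hU := solU_pos hν hy0 hy1.le n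
  rw [← h.wronskian hν hy0 n, zero_add]
  calc |p n * solV ν y n - solU ν y n * d n|
      ≤ |p n| * |solV ν y n| + solU ν y n * |d n| := by
        refine (abs_sub _ _).trans ?_
        rw [abs_mul, abs_mul, abs_of_pos hU]
    _ ≤ |p n| * (C * (A * r)) + solU ν y n * (δ * r) := by gcongr
    _ = C * A * (|p n| * r) + δ * (solU ν y n * r) := by ring
    _ ≤ C * A * (|p n| * r) + δ * (B * A) := by gcongr
    _ < C * A * δ + δ * (B * A) := by gcongr
    _ = ε := by rw [hδ]; field_simp; ring

theorem eq_zero_of_mem_Ioc (h : IsSol ν μ p d) (hν : 0 < ν) (hp : Summable fun n => p n ^ 2)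
    {y : ℝ} (hy : 1 / 2 ≤ y) (hy1 : y < 1) (hμ : μ = y * (1 - y))
    (hne : y = 1 / 2 ∨ charFun y ν ≠ 0) (n : ℕ) : p n = 0 := by
  subst hμ
  have hy0 : 0 < y := by linarith
  have h0 := h.wronskian_eq_zero hν hp hy hy1
  by_cases hp0 : p 0 = 0
  · exact (h.eq_zero_of_p_zero hp0 n).1
  exfalso
  have hV : solV ν y 0 = 0 := (mul_eq_zero.1 h0).resolve_left hp0
  rcases hne with rfl | hne
  -- At y = 1/2 the condition V(0) = 0 makes p a multiple of U, whose square is at least of order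
  -- 1/n.
  · have hU0 := solU_pos hν hy0 hy1.le 0
    have hind : ∀ n, p n * solU ν (1 / 2) 0 = p 0 * solU ν (1 / 2) n ∧
        d n * solU ν (1 / 2) 0 = p 0 * solV ν (1 / 2) n := by
      intro n
      induction n with
      | zero => exact ⟨rfl, by rw [h.d_zero, hV]; ring⟩
      | succ n ih =>
        have h2 : d (n + 1) * solU ν (1 / 2) 0 = p 0 * solV ν (1 / 2) (n + 1) := by
          rw [h.d_succ, solV_succ hν hy0]
          linear_combination ih.2 + 1 / 2 * (1 - 1 / 2) * ih.1
        refine ⟨?_, h2⟩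
        rw [h.p_succ, solU_succ hν hy0]
        linear_combination ih.1 - h2 / bSeq ν n
    obtain ⟨c, hc, H⟩ := exists_le_weight hν hy0
    refine not_summable_of_div_le (c := (p 0 / solU ν (1 / 2) 0 * (c / 2)) ^ 2) (by positivity) ?_
      ((summable_nat_add_iff 1).2 hp)
    refine Eventually.of_forall fun n => ?_
    have h1 : p (n + 1) = p 0 / solU ν (1 / 2) 0 * solU ν (1 / 2) (n + 1) := by
      rw [div_mul_eq_mul_div, eq_div_iff hU0.ne']
      exact (hind (n + 1)).1
    have h2 : c / 2 * ((n : ℝ) + 1) ^ (-(1 / 2) : ℝ) ≤ solU ν (1 / 2) (n + 1) := by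
      have := half_weight_le_solU hν hy0 hy1.le (n + 1)
      have := H n
      linarith
    have h3 : (((n : ℝ) + 1) ^ (-(1 / 2) : ℝ)) ^ 2 = 1 / ((n : ℝ) + 1) := by
      rw [← Real.rpow_natCast, ← Real.rpow_mul (by positivity)]
      norm_num
      rw [Real.rpow_neg_one]
    rw [h1, mul_pow, mul_pow, div_eq_mul_one_div, ← h3, mul_assoc, ← mul_pow (c / 2)]
    gcongr
  · rw [solV_zero] at hV
    have : ν * y ≠ 0 := by positivity
    exact hne ((mul_eq_zero.1 hV).resolve_left this)

theorem exists_of_ne_zero (h : IsSol ν μ p d) (hν : 0 < ν) (hp : Summable fun n => p n ^ 2)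
    {n : ℕ} (hn : p n ≠ 0) :
    ∃ y ∈ Set.Ioo (1 / 2 : ℝ) 1, charFun y ν = 0 ∧ μ = y * (1 - y) := by
  have h1 : 0 < μ := by
    by_contra! h1
    exact hn (h.eq_zero_of_nonpos hν hp h1 n)
  have h2 : μ ≤ 1 / 4 := by
    by_contra! h2
    exact hn (h.eq_zero_of_quarter_lt hν hp h2 n)
  set x := √(1 / 4 - μ) with hx
  have hx0 : 0 ≤ x := Real.sqrt_nonneg _
  have hx2 : x ^ 2 = 1 / 4 - μ := Real.sq_sqrt (by linarith)
  have hx1 : x < 1 / 2 := by nlinarith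
  have hμ : μ = (x + 1 / 2) * (1 - (x + 1 / 2)) := by linarith
  by_contra! hcon
  refine hn (h.eq_zero_of_mem_Ioc hν hp (y := x + 1 / 2) (by linarith) (by linarith) hμ ?_ n)
  rcases hx0.eq_or_lt with h3 | h3
  · left; linarith
  · right
    intro h4
    exact hcon _ ⟨by linarith, by linarith⟩ h4 hμ

end IsSol

/-! ### The point spectrum of the Jacobi operator -/

theorem memℓp_two_iff {f : ℕ → ℂ} : Memℓp f 2 ↔ Summable fun n => ‖f n‖ ^ 2 := by
  rw [memℓp_gen_iff (by norm_num)]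
  norm_num

/-- Summing rows 0 to n telescopes the matrix into first-order form. -/
theorem jacobiMul_eq_smul_iff {b : ℕ → ℝ} {f : ℕ → ℂ} {μ : ℂ} :
    jacobiMul b f = μ • f ↔
      ∀ n, (b n : ℂ) * (f n - f (n + 1)) = μ * ∑ k ∈ Finset.range (n + 1), f k := by
  constructor
  · intro h n
    induction n with
    | zero =>
      have h0 := congrFun h 0
      simp only [jacobiMul, Pi.smul_apply, smul_eq_mul] at h0
      simp only [zero_add, Finset.sum_range_one]
      linear_combination h0
    | succ n ih =>
      have h0 := congrFun h (n + 1)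
      simp only [jacobiMul, Pi.smul_apply, smul_eq_mul] at h0
      rw [Finset.sum_range_succ]
      linear_combination h0 + ih
  · intro h
    funext n
    cases n with
    | zero =>
      have h0 := h 0
      simp only [zero_add, Finset.sum_range_one] at h0
      simp only [jacobiMul, Pi.smul_apply, smul_eq_mul]
      linear_combination h0
    | succ n =>
      have h0 := h n
      have h1 := h (n + 1)
      rw [Finset.sum_range_succ] at h1
      simp only [jacobiMul, Pi.smul_apply, smul_eq_mul]
      linear_combination h1 - h0

theorem mem_pointSpectrum_jacobiOp_iff {b : ℕ → ℝ} {μ : ℂ} :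
    μ ∈ pointSpectrum (jacobiOp b) ↔
      ∃ f : ℕ → ℂ, f ≠ 0 ∧ (Summable fun n => ‖f n‖ ^ 2) ∧ jacobiMul b f = μ • f := by
  constructor
  · rintro ⟨x, hx0, hx⟩
    refine ⟨((x : ell2) : ℕ → ℂ), fun h => hx0 (lp.ext h), memℓp_two_iff.1 (lp.memℓp _), ?_⟩
    exact congrArg (fun z : ell2 => (z : ℕ → ℂ)) hx
  · rintro ⟨f, hf0, hf, h⟩
    have hf' : Memℓp f 2 := memℓp_two_iff.2 hf
    let v : ell2 := ⟨f, hf'⟩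
    have hv : v ∈ (jacobiOp b).domain := by
      change Memℓp (jacobiMul b f) 2
      rw [h]
      exact hf'.const_smul μ
    refine ⟨⟨v, hv⟩, fun h0 => hf0 (congrArg (fun z : ell2 => (z : ℕ → ℂ)) h0), ?_⟩
    exact lp.ext h

theorem im_eq_zero_of_eigen {ν : ℝ} (hν : 0 < ν) {μ : ℂ} {f : ℕ → ℂ} (hf0 : f ≠ 0)
    (hf : Summable fun n => ‖f n‖ ^ 2)
    (h : ∀ n, (bSeq ν n : ℂ) * (f n - f (n + 1)) = μ * ∑ k ∈ Finset.range (n + 1), f k) :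
    μ.im = 0 := by
  by_contra hμ
  set D : ℕ → ℂ := fun n => μ * ∑ k ∈ Finset.range n, f k with hD
  have hDs : ∀ n, D (n + 1) = D n + μ * f n := fun n => by
    simp only [hD, Finset.sum_range_succ]
    ring
  -- Since b is real, q grows by ‖f(n)‖² at each step; being 0 at the start and small infinitely
  -- often, it forces f = 0.
  set q : ℕ → ℝ := fun n => (starRingEnd ℂ (f n) * D n).im / μ.im with hq
  have hrec : ∀ n, q (n + 1) = q n + ‖f n‖ ^ 2 := fun n => by
    have hb : (bSeq ν n : ℂ) ≠ 0 := by exact_mod_cast (bSeq_pos hν n).ne'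
    have h1 : f (n + 1) = f n - D (n + 1) / bSeq ν n := by
      have h2 : (bSeq ν n : ℂ) * (f n - f (n + 1)) = D (n + 1) := h n
      rw [← h2]
      field_simp
      ring
    have h3 : starRingEnd ℂ (f (n + 1)) * D (n + 1) = starRingEnd ℂ (f n) * D n +
        μ * ((‖f n‖ ^ 2 : ℝ) : ℂ) - ((‖D (n + 1)‖ ^ 2 / bSeq ν n : ℝ) : ℂ) := by
      rw [h1, map_sub, map_div₀, Complex.conj_ofReal, sub_mul, div_mul_eq_mul_div,
        Complex.conj_mul' (D (n + 1)), hDs n]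
      push_cast
      linear_combination μ * Complex.conj_mul' (f n)
    have h4 : (starRingEnd ℂ (f (n + 1)) * D (n + 1)).im =
        (starRingEnd ℂ (f n) * D n).im + μ.im * ‖f n‖ ^ 2 := by
      rw [h3, Complex.sub_im, Complex.add_im, Complex.ofReal_im, Complex.im_mul_ofReal, sub_zero]
    simp only [hq]
    rw [h4]
    field_simp
  have hq0 := eq_zero_of_monotone_of_frequently (q := q)
    (monotone_nat_of_le_succ fun n => by rw [hrec]; linarith [sq_nonneg ‖f n‖])
    (by simp [hq, hD]) fun ε hε => by
      set M := ‖μ‖ / |μ.im| with hM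
      have hM0 : 0 < M := div_pos (norm_pos_iff.2 fun h => hμ (by simp [h])) (abs_pos.2 hμ)
      refine (frequently_small hf hν (show 0 < ε / M by positivity)).mono fun n ⟨h1, h2⟩ => ?_
      have hs : 0 < ν + n := by positivity
      set S := ∑ k ∈ Finset.range n, ‖f k‖ with hS
      have hS0 : 0 ≤ S := Finset.sum_nonneg fun k _ => norm_nonneg _
      have h3 : ‖f n‖ * S < ε / M := by
        refine lt_of_pow_lt_pow_left₀ 2 (by positivity) ?_
        rw [div_lt_iff₀ hs] at h2
        have h3 : (ν + n) * (‖f n‖ * S) ^ 2 < (ν + n) * (ε / M) ^ 2 := by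
          calc (ν + n) * (‖f n‖ * S) ^ 2 = (ν + n) * ‖f n‖ ^ 2 * S ^ 2 := by ring
            _ ≤ ε / M * S ^ 2 := by gcongr
            _ < ε / M * (ε / M * (ν + n)) := by gcongr
            _ = _ := by ring
        exact lt_of_mul_lt_mul_left h3 hs.le
      refine (le_abs_self _).trans_lt ?_
      calc |q n| = |(starRingEnd ℂ (f n) * D n).im| / |μ.im| := abs_div _ _
        _ ≤ (‖f n‖ * (‖μ‖ * S)) / |μ.im| := by
            gcongr
            refine (Complex.abs_im_le_norm _).trans ?_
            rw [norm_mul, RCLike.norm_conj, norm_mul]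
            gcongr
            exact norm_sum_le _ _
        _ = M * (‖f n‖ * S) := by rw [hM]; ring
        _ < M * (ε / M) := by gcongr
        _ = ε := by field_simp
  refine hf0 (funext fun n => ?_)
  have h1 := hrec n
  rw [hq0, hq0, zero_add] at h1
  simpa using h1.symm

theorem mem_pointSpectrum_J_iff {ν : ℝ} (hν : 0 < ν) {μ : ℂ} :
    μ ∈ pointSpectrum (J ν) ↔
      ∃ y ∈ Set.Ioo (1 / 2 : ℝ) 1, charFun y ν = 0 ∧ μ = ((y * (1 - y) : ℝ) : ℂ) := by
  rw [J, mem_pointSpectrum_jacobiOp_iff]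
  simp_rw [jacobiMul_eq_smul_iff]
  constructor
  · rintro ⟨f, hf0, hf, h⟩
    have him := im_eq_zero_of_eigen hν hf0 hf h
    obtain ⟨m, rfl⟩ : ∃ m : ℝ, (m : ℂ) = μ := ⟨μ.re, Complex.ext rfl him.symm⟩
    obtain ⟨n, hn⟩ := Function.ne_iff.1 hf0
    have hb : ∀ n, (bSeq ν n : ℝ) ≠ 0 := fun n => (bSeq_pos hν n).ne'
    -- As μ and b are real, real and imaginary parts are separate solutions, and at least one is
    -- nonzero.
    have hre : IsSol ν m (fun n => (f n).re) (fun n => m * ∑ k ∈ Finset.range n, (f k).re) := by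
      refine ⟨by simp, fun n => by rw [Finset.sum_range_succ]; ring, fun n => ?_⟩
      have h1 := congrArg Complex.re (h n)
      rw [Complex.re_ofReal_mul, Complex.re_ofReal_mul, Complex.sub_re, Complex.re_sum] at h1
      have := hb n
      rw [← h1]
      field_simp
      ring
    have him : IsSol ν m (fun n => (f n).im) (fun n => m * ∑ k ∈ Finset.range n, (f k).im) := by
      refine ⟨by simp, fun n => by rw [Finset.sum_range_succ]; ring, fun n => ?_⟩
      have h1 := congrArg Complex.im (h n)
      rw [Complex.im_ofReal_mul, Complex.im_ofReal_mul, Complex.sub_im, Complex.im_sum] at h1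
      have := hb n
      rw [← h1]
      field_simp
      ring
    have hsq : ∀ n, ‖f n‖ ^ 2 = (f n).re ^ 2 + (f n).im ^ 2 := fun n => by
      rw [Complex.sq_norm, Complex.normSq_apply]
      ring
    by_cases h0 : (f n).re = 0
    · have h1 : (f n).im ≠ 0 := fun h1 => hn (Complex.ext h0 h1)
      obtain ⟨y, hy, h2, h3⟩ := him.exists_of_ne_zero hν (hf.of_nonneg_of_le
        (fun _ => sq_nonneg _) fun n => by rw [hsq]; linarith [sq_nonneg (f n).re]) h1
      exact ⟨y, hy, h2, by rw [h3]⟩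
    · obtain ⟨y, hy, h2, h3⟩ := hre.exists_of_ne_zero hν (hf.of_nonneg_of_le
        (fun _ => sq_nonneg _) fun n => by rw [hsq]; linarith [sq_nonneg (f n).im]) h0
      exact ⟨y, hy, h2, by rw [h3]⟩
  · rintro ⟨y, ⟨hy, hy1⟩, h0, rfl⟩
    have hy0 : 0 < y := by linarith
    have hU := solU_pos hν hy0 hy1.le
    refine ⟨fun n => (solU ν y n : ℂ), fun h => (hU 0).ne' ?_, ?_, fun n => ?_⟩
    · simpa using congrFun h 0
    · have h1 : Summable fun n : ℕ => (ν ^ y) ^ 2 * (ν + n) ^ (-(2 * y)) := by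
        refine Summable.mul_left _ ?_
        have h2 := (Real.summable_one_div_nat_add_rpow ν (2 * y)).2 (by linarith)
        refine h2.congr fun n => ?_
        have : 0 < ν + n := by positivity
        rw [Real.rpow_neg this.le, add_comm, abs_of_pos this, one_div]
      refine h1.of_nonneg_of_le (fun _ => sq_nonneg _) fun n => ?_
      have hs : 0 < ν + n := by positivity
      rw [Complex.norm_real, Real.norm_of_nonneg (hU n).le,
        show -(2 * y) = -y + -y by ring, Real.rpow_add hs, ← sq, ← mul_pow]
      gcongr
      · exact (hU n).le
      · exact solU_le hν hy0 hy1.le n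
    · have hV : ∀ n, solV ν y n = y * (1 - y) * ∑ k ∈ Finset.range n, solU ν y k := fun n => by
        induction n with
        | zero => rw [solV_zero, h0]; simp
        | succ n ih => rw [solV_succ hν hy0, ih, Finset.sum_range_succ]; ring
      have h1 := solU_succ hν hy0 n
      rw [hV] at h1
      have h2 : bSeq ν n * (solU ν y n - solU ν y (n + 1)) =
          y * (1 - y) * ∑ k ∈ Finset.range (n + 1), solU ν y k := by
        have := (bSeq_pos hν n).ne'
        rw [h1]
        field_simp
        ring
      dsimp only
      exact_mod_cast h2
-- Complex parameters and the implicit function theorem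
local notation "pochC" a:max n:max => Polynomial.eval a (ascPochhammer ℂ n)

/-- A series of holomorphic functions dominated by a summable sequence on a ball is continuously
differentiable at the center. -/
theorem contDiffAt_one_tsum_of_norm_le {E : Type*} [NormedAddCommGroup E] [NormedSpace ℂ E]
    {f : ℕ → E → ℂ} {M : ℕ → ℝ} {c : E} {r : ℝ} (hr : 0 < r)
    (hf : ∀ n, ContDiffOn ℂ 1 (f n) (Metric.ball c r)) (hM : Summable M)
    (hfM : ∀ n, ∀ z ∈ Metric.ball c r, ‖f n z‖ ≤ M n) :
    ContDiffAt ℂ 1 (fun z => ∑' n, f n z) c := by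
  set s := Metric.ball c (r / 2) with hs
  have hsub : s ⊆ Metric.ball c r := Metric.ball_subset_ball (by linarith)
  have hball : ∀ z ∈ s, Metric.ball z (r / 2) ⊆ Metric.ball c r := fun z hz =>
    Metric.ball_subset_ball' (by rw [hs, Metric.mem_ball] at hz; linarith)
  have hd : ∀ n, DifferentiableOn ℂ (f n) (Metric.ball c r) := fun n =>
    (hf n).differentiableOn (by norm_num)
  have hbound : ∀ n, ∀ z ∈ s, ‖fderiv ℂ (f n) z‖ ≤ 2 * M n / (r / 2) := fun n z hz => by
    -- A Cauchy-type estimate on balls of radius r/2: there f(n) stays within 2 M(n) of its central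
    -- value.
    refine Complex.norm_fderiv_le_div_of_mapsTo_ball ((hd n).mono (hball z hz)) (fun w hw => ?_)
      (by positivity)
    rw [Metric.mem_closedBall, dist_eq_norm]
    refine (norm_sub_le _ _).trans ?_
    linarith [hfM n w (hball z hz hw), hfM n z (hsub hz)]
  have hsum : Summable fun n => 2 * M n / (r / 2) := (hM.mul_left 2).div_const _
  have hcs : c ∈ s := Metric.mem_ball_self (by positivity)
  refine contDiffAt_one_iff.2 ⟨fun z => ∑' n, fderiv ℂ (f n) z, s,
    Metric.ball_mem_nhds _ (by positivity), ?_, fun z hz => ?_⟩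
  · refine continuousOn_tsum (fun n => ?_) hsum hbound
    exact ((hf n).continuousOn_fderiv_of_isOpen Metric.isOpen_ball (by norm_num)).mono hsub
  · let _ : NormedSpace ℝ E := NormedSpace.restrictScalars ℝ ℂ E
    refine hasFDerivAt_tsum_of_isPreconnected hsum Metric.isOpen_ball
      (convex_ball c (r / 2)).isPreconnected (fun n w hw => ?_) hbound hcs
      (Summable.of_norm_bounded hM fun n => hfM n c (hsub hcs)) hz
    exact ((hd n).differentiableAt (Metric.isOpen_ball.mem_nhds (hsub hw))).hasFDerivAt

/-- The implicit function theorem for a function of two complex variables. -/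
theorem exists_analyticAt_implicit {F : ℂ × ℂ → ℂ} {u : ℂ × ℂ} (hF : ContDiffAt ℂ 1 F u)
    (h0 : F u = 0) (hne : fderiv ℂ F u (0, 1) ≠ 0) :
    ∃ ψ : ℂ → ℂ, AnalyticAt ℂ ψ u.1 ∧ ∀ᶠ v in 𝓝 u, F v = 0 → ψ v.1 = v.2 := by
  set L := fderiv ℂ F u
  have hL : HasFDerivAt F L u := (hF.differentiableAt (by norm_num)).hasFDerivAt
  -- The map (ν, y) ↦ (ν, F) is locally invertible; the second component of its inverse at (ν, 0) is
  -- the implicit function.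
  set Ψ : ℂ × ℂ → ℂ × ℂ := fun v => (v.1, F v) with hΨ
  have hΨc : ContDiffAt ℂ 1 Ψ u := contDiffAt_fst.prodMk hF
  let T : ℂ × ℂ →L[ℂ] ℂ × ℂ := (ContinuousLinearMap.fst ℂ ℂ ℂ).prod L
  have hT : HasFDerivAt Ψ T u := hasFDerivAt_fst.prodMk hL
  have hinj : LinearMap.ker (T : ℂ × ℂ →ₗ[ℂ] ℂ × ℂ) = ⊥ := by
    rw [LinearMap.ker_eq_bot']
    rintro ⟨a, b⟩ hab
    have h1 : a = 0 := congrArg Prod.fst hab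
    have h2 : L (a, b) = 0 := congrArg Prod.snd hab
    have h3 : ((a, b) : ℂ × ℂ) = b • ((0, 1) : ℂ × ℂ) := by simp [h1]
    rw [h3, map_smul, smul_eq_mul, mul_eq_zero] at h2
    rw [h1, h2.resolve_right hne]
    rfl
  let e : (ℂ × ℂ) ≃L[ℂ] ℂ × ℂ :=
    (LinearEquiv.ofInjectiveEndo (T : ℂ × ℂ →ₗ[ℂ] ℂ × ℂ)
      (LinearMap.ker_eq_bot.1 hinj)).toContinuousLinearEquiv
  have he : HasFDerivAt Ψ (e : ℂ × ℂ →L[ℂ] ℂ × ℂ) u := by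
    convert! hT
  set Φ := hΨc.localInverse he one_ne_zero with hΦ
  have hΦc : ContDiffAt ℂ 1 Φ (u.1, 0) := by
    have h1 := hΨc.to_localInverse he one_ne_zero
    have hu : Ψ u = (u.1, 0) := by simp [hΨ, h0]
    rwa [hu] at h1
  have hline : ContDiffAt ℂ 1 (fun z : ℂ => (z, (0 : ℂ))) u.1 :=
    contDiffAt_id.prodMk contDiffAt_const
  have hψ : ContDiffAt ℂ 1 (fun z : ℂ => (Φ (z, 0)).2) u.1 := (hΦc.comp u.1 hline).snd
  refine ⟨fun z => (Φ (z, 0)).2, ?_, ?_⟩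
  · rw [Complex.analyticAt_iff_eventually_differentiableAt]
    filter_upwards [hψ.eventually (by norm_num)] with z hz
    exact hz.differentiableAt (by norm_num)
  · filter_upwards [(hΨc.hasStrictFDerivAt' he one_ne_zero).eventually_left_inverse] with v hv hFv
    have h1 : Φ (Ψ v) = v := hv
    simp only [hΨ, hFv] at h1
    exact congrArg Prod.snd h1

/-- The terms of the series `charFun` for complex parameters `(ν, y)`. -/
def charTermC (n : ℕ) (v : ℂ × ℂ) : ℂ :=
  (pochC (v.2 - 1) n * pochC (v.2) n * pochC (v.2 + 1) n) /
    ((n.factorial : ℂ) * pochC (2 * v.2) n * pochC (v.2 + v.1) n)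

/-- The function `charFun` for complex parameters `(ν, y)`. -/
def charFunC (v : ℂ × ℂ) : ℂ := ∑' n, charTermC n v

theorem charFunC_ofReal (ν y : ℝ) : charFunC ((ν : ℂ), (y : ℂ)) = (charFun y ν : ℂ) := by
  rw [charFunC, charFun, hyp3F2, Complex.ofReal_tsum]
  congr 1
  funext n
  have h : ∀ a : ℝ, ((poch a n : ℝ) : ℂ) = pochC (a : ℂ) n := fun a => by
    rw [ascPochhammer_eval_eq_prod, ascPochhammer_eval_eq_prod]
    push_cast
    rfl
  rw [charTermC, hyp3F2Term]
  push_cast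
  simp only [h]
  push_cast
  rfl

theorem norm_ascPochhammer_le {a : ℂ} {A : ℝ} (h : ‖a‖ ≤ A) (n : ℕ) :
    ‖pochC a n‖ ≤ poch A n := by
  rw [ascPochhammer_eval_eq_prod, ascPochhammer_eval_eq_prod, norm_prod]
  refine Finset.prod_le_prod (fun j _ => norm_nonneg _) fun j _ => ?_
  refine (norm_add_le _ _).trans ?_
  rw [Complex.norm_natCast]
  gcongr

theorem le_norm_ascPochhammer {b : ℂ} {p : ℝ} (hp : 0 < p) (h : p ≤ b.re) (n : ℕ) :
    poch p n ≤ ‖pochC b n‖ := by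
  rw [ascPochhammer_eval_eq_prod, ascPochhammer_eval_eq_prod, norm_prod]
  refine Finset.prod_le_prod (fun j _ => by positivity) fun j _ => ?_
  refine le_trans ?_ (Complex.re_le_norm _)
  rw [Complex.add_re, Complex.natCast_re]
  gcongr

theorem norm_charTermC_succ_le {v : ℂ × ℂ} {A p q : ℝ} (hp : 0 < p) (hq : 0 < q)
    (hA : ‖v.2‖ ≤ A) (hp' : p ≤ (2 * v.2).re) (hq' : q ≤ (v.2 + v.1).re) (n : ℕ) :
    ‖charTermC (n + 1) v‖ ≤ ‖v.2 - 1‖ * majorant A p q n := by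
  have hA0 : 0 < A := by
    refine lt_of_lt_of_le (norm_pos_iff.2 fun h => ?_) hA
    rw [h] at hp'
    simp at hp'
    linarith
  have h1 := ascPochhammer_pos (n + 1) p hp
  have h2 := ascPochhammer_pos (n + 1) q hq
  have h3 := norm_ascPochhammer_le hA n
  have h4 := norm_ascPochhammer_le hA (n + 1)
  have h5 : ‖pochC (v.2 + 1) (n + 1)‖ ≤ poch (A + 1) (n + 1) :=
    norm_ascPochhammer_le ((norm_add_le _ _).trans (by simpa using hA)) (n + 1)
  have h6 := le_norm_ascPochhammer hp hp' (n + 1)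
  have h7 := le_norm_ascPochhammer hq hq' (n + 1)
  rw [charTermC, ascPochhammer_eval_succ_left (v.2 - 1), sub_add_cancel, norm_div, norm_mul,
    norm_mul, norm_mul, norm_mul, norm_mul, Complex.norm_natCast, mul_assoc, mul_assoc,
    mul_div_assoc, majorant, ← mul_assoc (‖pochC (v.2) n‖)]
  have h8 := ascPochhammer_pos n A hA0
  have h9 := ascPochhammer_pos (n + 1) A hA0
  have h10 := ascPochhammer_pos (n + 1) (A + 1) (by positivity)
  gcongr

theorem contDiffAt_charFunC {ν y : ℝ} (hν : 0 < ν) (hy : 1 / 2 ≤ y) (hy1 : y ≤ 1) :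
    ContDiffAt ℂ 1 charFunC ((ν : ℂ), (y : ℂ)) := by
  -- Summability of the perturbed majorant needs 3(y + ε) < (2y - 2ε) + (y + ν - 2ε), that is, 7ε <
  -- ν; the bound 1/8 keeps the lower bound for Re 2y positive and the modulus of y - 1 at most 1.
  set ε := min (ν / 16) (1 / 8)
  have hε : 0 < ε := by positivity
  have hε1 : ε ≤ ν / 16 := min_le_left _ _
  have hε2 : ε ≤ 1 / 8 := min_le_right _ _
  have hp : 0 < 2 * y - 2 * ε := by linarith
  have hq : 0 < y + ν - 2 * ε := by linarith
  have hA : 0 < y + ε := by linarith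
  have hball : ∀ v ∈ Metric.ball ((ν : ℂ), (y : ℂ)) ε,
      ‖v.2‖ ≤ y + ε ∧ 2 * y - 2 * ε ≤ (2 * v.2).re ∧ y + ν - 2 * ε ≤ (v.2 + v.1).re ∧
        ‖v.2 - 1‖ ≤ 1 := by
    intro v hv
    rw [Metric.mem_ball, Prod.dist_eq, max_lt_iff, dist_eq_norm, dist_eq_norm] at hv
    obtain ⟨h1, h2⟩ := hv
    have h3 := (abs_le.1 (Complex.abs_re_le_norm (v.1 - ν))).1
    have h4 := (abs_le.1 (Complex.abs_re_le_norm (v.2 - y))).1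
    simp only [Complex.sub_re, Complex.ofReal_re] at h3 h4
    refine ⟨?_, ?_, ?_, ?_⟩
    · calc ‖v.2‖ = ‖(y : ℂ) + (v.2 - y)‖ := by ring_nf
        _ ≤ ‖(y : ℂ)‖ + ‖v.2 - y‖ := norm_add_le _ _
        _ ≤ y + ε := by
          rw [Complex.norm_real, Real.norm_of_nonneg (by linarith)]
          linarith
    · simp only [Complex.mul_re, Complex.re_ofNat, Complex.im_ofNat]
      linarith
    · rw [Complex.add_re]
      linarith
    · calc ‖v.2 - 1‖ = ‖((y - 1 : ℝ) : ℂ) + (v.2 - y)‖ := by push_cast; ring_nf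
        _ ≤ ‖((y - 1 : ℝ) : ℂ)‖ + ‖v.2 - y‖ := norm_add_le _ _
        _ ≤ 1 := by
          rw [Complex.norm_real, Real.norm_of_nonpos (by linarith)]
          linarith
  have hM : Summable fun n => if n = 0 then (1 : ℝ) else
      majorant (y + ε) (2 * y - 2 * ε) (y + ν - 2 * ε) (n - 1) := by
    rw [← summable_nat_add_iff 1]
    simpa using summable_majorant hA hp hq (by linarith)
  refine contDiffAt_one_tsum_of_norm_le hε (fun n => ?_) hM fun n v hv => ?_
  · have hpoly : ∀ g : ℂ × ℂ → ℂ, ContDiff ℂ 1 g → ContDiff ℂ 1 fun v => pochC (g v) n := by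
      intro g hg
      simp_rw [ascPochhammer_eval_eq_prod]
      exact contDiff_prod fun j _ => hg.add contDiff_const
    have hne : ∀ (b : ℂ) {p : ℝ}, 0 < p → p ≤ b.re → pochC b n ≠ 0 := fun b p hp hb =>
      norm_pos_iff.1 ((ascPochhammer_pos n p hp).trans_le (le_norm_ascPochhammer hp hb n))
    refine ContDiffOn.div ?_ ?_ fun v hv => ?_
    · exact (((hpoly _ (contDiff_snd.sub contDiff_const)).mul (hpoly _ contDiff_snd)).mul
        (hpoly _ (contDiff_snd.add contDiff_const))).contDiffOn
    · exact ((contDiff_const.mul (hpoly _ (contDiff_const.mul contDiff_snd))).mul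
        (hpoly _ (contDiff_snd.add contDiff_fst))).contDiffOn
    · obtain ⟨-, h2, h3, -⟩ := hball v hv
      exact mul_ne_zero (mul_ne_zero (by exact_mod_cast n.factorial_ne_zero) (hne _ hp h2))
        (hne _ hq h3)
  · obtain ⟨h1, h2, h3, h4⟩ := hball v hv
    cases n with
    | zero => simp [charTermC]
    | succ n =>
      rw [if_neg n.succ_ne_zero, Nat.add_sub_cancel]
      exact (norm_charTermC_succ_le hp hq h1 h2 h3 n).trans
        (mul_le_of_le_one_left (majorant_nonneg hA hp hq n) h4)

theorem continuousAt_charFun {ν y : ℝ} (hν : 0 < ν) (hy : 1 / 2 ≤ y) (hy1 : y ≤ 1) :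
    ContinuousAt (fun v : ℝ × ℝ => charFun v.2 v.1) (ν, y) := by
  have h1 : ContinuousAt charFunC ((ν : ℂ), (y : ℂ)) :=
    (contDiffAt_charFunC hν hy hy1).continuousAt
  have h2 : ContinuousAt (fun v : ℝ × ℝ => ((v.1 : ℂ), (v.2 : ℂ))) (ν, y) := by fun_prop
  have h3 : ContinuousAt (fun v : ℝ × ℝ => charFunC ((v.1 : ℂ), (v.2 : ℂ))) (ν, y) :=
    ContinuousAt.comp (g := charFunC) (f := fun v : ℝ × ℝ => ((v.1 : ℂ), (v.2 : ℂ))) (x := (ν, y))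
      h1 h2
  have h4 := Complex.continuous_re.continuousAt.comp h3
  refine h4.congr (Eventually.of_forall fun v => ?_)
  simp [charFunC_ofReal]

/-- At a zero, `charFun_lower_bound` keeps the right difference quotients in y above (2y - 1)/(2ν) >
0. -/
theorem fderiv_charFunC_ne_zero {ν y : ℝ} (hν : 0 < ν) (hy : 1 / 2 < y) (hy1 : y < 1)
    (h0 : charFun y ν = 0) : fderiv ℂ charFunC ((ν : ℂ), (y : ℂ)) (0, 1) ≠ 0 := by
  intro hL
  have h1 : HasFDerivAt charFunC (fderiv ℂ charFunC ((ν : ℂ), (y : ℂ))) ((ν : ℂ), (y : ℂ)) :=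
    ((contDiffAt_charFunC hν hy.le hy1.le).differentiableAt (by norm_num)).hasFDerivAt
  have h2 : HasDerivAt (fun z : ℂ => ((ν : ℂ), z)) ((0 : ℂ), (1 : ℂ)) (y : ℂ) :=
    (hasDerivAt_const _ _).prodMk (hasDerivAt_id _)
  have h3 : HasDerivAt (fun z : ℂ => charFunC ((ν : ℂ), z)) 0 (y : ℂ) := by
    have h := h1.comp_hasDerivAt (y : ℂ) h2
    rwa [hL] at h
  have h4 : HasDerivAt (fun t : ℝ => charFun t ν) 0 y := by
    have h := h3.real_of_complex
    simpa only [charFunC_ofReal, Complex.ofReal_re, Complex.zero_re] using h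
  have h5 := (hasDerivWithinAt_iff_tendsto_slope' (s := Set.Ioi y) (by simp)).1
    h4.hasDerivWithinAt
  have h6 : (2 * y - 1) / (2 * ν) ≤ 0 := by
    refine ge_of_tendsto h5 ?_
    filter_upwards [Ioo_mem_nhdsGT hy1] with t ht
    have h7 := charFun_lower_bound hν hy.le ht.1 ht.2 h0.ge
    have h8 : 0 < t - y := by linarith [ht.1]
    rw [slope_def_field, h0, sub_zero, le_div_iff₀ h8]
    refine le_trans ?_ h7
    rw [div_mul_eq_mul_div]
    exact div_le_div_of_nonneg_right (by nlinarith) (by positivity)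
  have : 0 < (2 * y - 1) / (2 * ν) := div_pos (by linarith) (by linarith)
  linarith

/-! ### Existence, uniqueness and regularity of the zeros -/

theorem continuousOn_charFun_left {y : ℝ} (hy : 1 / 2 ≤ y) (hy1 : y ≤ 1) :
    ContinuousOn (fun ν => charFun y ν) (Set.Ioi 0) := fun ν hν =>
  (ContinuousAt.comp (g := fun v : ℝ × ℝ => charFun v.2 v.1) (f := fun ν : ℝ => (ν, y)) (x := ν)
    (continuousAt_charFun hν hy hy1) (by fun_prop)).continuousWithinAt

theorem continuousOn_charFun_right {ν : ℝ} (hν : 0 < ν) :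
    ContinuousOn (fun y => charFun y ν) (Set.Icc (1 / 2) 1) := fun y hy =>
  (ContinuousAt.comp (g := fun v : ℝ × ℝ => charFun v.2 v.1) (f := fun y : ℝ => (ν, y)) (x := y)
    (continuousAt_charFun hν hy.1 hy.2) (by fun_prop)).continuousWithinAt

theorem exists_charFun_neg {y t : ℝ} (hy : 1 / 2 ≤ y) (hy1 : y < 1) (ht : 0 < t) :
    ∃ s ∈ Set.Ioo 0 t, charFun y s < 0 := by
  have hl : 0 < y * (1 - y) := mul_pos (by linarith) (by linarith)
  refine ⟨min (t / 2) (y * (1 - y) / 4), ⟨by positivity, ?_⟩,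
    charFun_neg_of_small (by linarith) hy1 (by positivity) ?_⟩
  · exact (min_le_left _ _).trans_lt (by linarith)
  · have h1 : 0 < min (t / 2) (y * (1 - y) / 4) := by positivity
    have h2 := min_le_right (t / 2) (y * (1 - y) / 4)
    have h3 : y * (1 - y) ≤ 1 / 4 := by nlinarith [sq_nonneg (y - 1 / 2)]
    nlinarith

/-- A zero of `charFun y` below a point where this function is positive. -/
theorem exists_charFun_eq_zero_left {y t : ℝ} (hy : 1 / 2 ≤ y) (hy1 : y < 1) (ht : 0 < t)
    (h : 0 < charFun y t) : ∃ s ∈ Set.Ioo 0 t, charFun y s = 0 := by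
  obtain ⟨s, ⟨hs, hst⟩, hneg⟩ := exists_charFun_neg hy hy1 ht
  obtain ⟨r, hr, hr0⟩ := intermediate_value_Ioo hst.le
    ((continuousOn_charFun_left hy hy1.le).mono fun r hr => hs.trans_le hr.1) ⟨hneg, h⟩
  exact ⟨r, ⟨hs.trans hr.1, hr.2⟩, hr0⟩

theorem charFun_pos_of_lt {ν y₁ y₂ : ℝ} (hν : 0 < ν) (h₁ : 1 / 2 ≤ y₁) (h : y₁ < y₂)
    (h₂ : y₂ < 1) (h0 : 0 ≤ charFun y₁ ν) : 0 < charFun y₂ ν := by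
  refine lt_of_lt_of_le ?_ (charFun_lower_bound hν h₁ h h₂ h0)
  exact div_pos (mul_pos (by linarith) (by linarith)) (by linarith)

theorem exists_charFun_eq_zero_right {ν : ℝ} (hν : 0 < ν) (h : charFun (1 / 2) ν < 0) :
    ∃ y ∈ Set.Ioo (1 / 2 : ℝ) 1, charFun y ν = 0 :=
  intermediate_value_Ioo (by norm_num) (continuousOn_charFun_right hν)
    ⟨h, by rw [charFun_one hν]; exact one_pos⟩

theorem charFun_zero_unique {ν y₁ y₂ : ℝ} (hν : 0 < ν) (h₁ : y₁ ∈ Set.Ioo (1 / 2 : ℝ) 1)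
    (h₂ : y₂ ∈ Set.Ioo (1 / 2 : ℝ) 1) (h₁0 : charFun y₁ ν = 0) (h₂0 : charFun y₂ ν = 0) :
    y₁ = y₂ := by
  by_contra hne
  rcases lt_or_gt_of_ne hne with h | h
  · exact (charFun_pos_of_lt hν h₁.1.le h h₂.2 h₁0.ge).ne' h₂0
  · exact (charFun_pos_of_lt hν h₂.1.le h h₁.2 h₂0.ge).ne' h₁0

/-- A continuous selection of zeros of `charFun` is real analytic. -/
theorem analyticAt_of_charFun_eq_zero {Y : ℝ → ℝ} {ν : ℝ} (hν : 0 < ν) (hY : ContinuousAt Y ν)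
    (hmem : Y ν ∈ Set.Ioo (1 / 2 : ℝ) 1) (h0 : ∀ᶠ s in 𝓝 ν, charFun (Y s) s = 0) :
    AnalyticAt ℝ Y ν := by
  have hν0 : charFun (Y ν) ν = 0 := h0.self_of_nhds
  obtain ⟨ψ, hψ, hev⟩ := exists_analyticAt_implicit
    (contDiffAt_charFunC hν hmem.1.le hmem.2.le) (by rw [charFunC_ofReal, hν0]; rfl)
    (fderiv_charFunC_ne_zero hν hmem.1 hmem.2 hν0)
  have hlift : Tendsto (fun s : ℝ => ((s : ℂ), (Y s : ℂ))) (𝓝 ν) (𝓝 ((ν : ℂ), (Y ν : ℂ))) := by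
    have h1 : ContinuousAt (fun s : ℝ => (s : ℂ)) ν := by fun_prop
    have h2 : ContinuousAt (fun s : ℝ => (Y s : ℂ)) ν :=
      Complex.continuous_ofReal.continuousAt.comp hY
    exact h1.prodMk h2
  refine hψ.re_ofReal.congr ?_
  filter_upwards [h0, hlift.eventually hev] with s hs hs'
  rw [hs' (by rw [charFunC_ofReal, hs]; rfl), Complex.ofReal_re]

theorem hyp3F2_eq_charFun (x ν : ℝ) :
    hyp3F2 (x - 1 / 2) (x + 1 / 2) (x + 3 / 2) (2 * x + 1) (x + ν + 1 / 2) =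
      charFun (x + 1 / 2) ν := by
  rw [charFun]
  ring_nf

theorem hyp3F2_eq_charFun_half (ν : ℝ) :
    hyp3F2 (-1 / 2) (1 / 2) (3 / 2) 1 (ν + 1 / 2) = charFun (1 / 2) ν := by
  rw [charFun]
  ring_nf

end HilbertL

end

/-! ### Assembly of the theorem -/

theorem mainTheorem2 :
    -- the hypergeometric series below converge absolutely
    (∀ ν > (0 : ℝ), ∀ x ≥ (0 : ℝ), Summable
      (HilbertL.hyp3F2Term (x - 1 / 2) (x + 1 / 2) (x + 3 / 2) (2 * x + 1) (x + ν + 1 / 2))) ∧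
    ∃ ν₀ ∈ Set.Ioo (0 : ℝ) (1 / 2),
      -- `ν₀` is the unique positive zero
      (∀ ν > (0 : ℝ),
        HilbertL.hyp3F2 (-1 / 2) (1 / 2) (3 / 2) 1 (ν + 1 / 2) = 0 ↔ ν = ν₀) ∧
      (∀ ν ≥ ν₀, HilbertL.pointSpectrum (HilbertL.J ν) = ∅) ∧
      ∃ x₀ : ℝ → ℝ,
        (∀ ν ∈ Set.Ioo 0 ν₀,
          -- `x₀ ν` is the unique zero in `(0, 1/2)`
          x₀ ν ∈ Set.Ioo (0 : ℝ) (1 / 2) ∧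
          (∀ x ∈ Set.Ioo (0 : ℝ) (1 / 2),
            HilbertL.hyp3F2 (x - 1 / 2) (x + 1 / 2) (x + 3 / 2) (2 * x + 1) (x + ν + 1 / 2) = 0
              ↔ x = x₀ ν) ∧
          HilbertL.pointSpectrum (HilbertL.J ν) = {((1 / 4 - x₀ ν ^ 2 : ℝ) : ℂ)}) ∧
        AnalyticOnNhd ℝ x₀ (Set.Ioo 0 ν₀) ∧
        StrictAntiOn x₀ (Set.Ioo 0 ν₀) ∧
        x₀ '' Set.Ioo 0 ν₀ = Set.Ioo (0 : ℝ) (1 / 2) := by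
  open HilbertL in
  refine ⟨fun ν hν x hx => ?_, ?_⟩
  · have h := summable_charFun_term (y := x + 1 / 2) (s := ν) (by linarith) hν
    convert! h using 2 <;> ring
  have hhalf : (1 / 2 : ℝ) < 1 := by norm_num
  obtain ⟨ν₀, hν₀, hz⟩ := exists_charFun_eq_zero_left le_rfl hhalf (by norm_num)
    charFun_half_half_pos
  have hmono := charFun_strictMonoOn (y := 1 / 2) (by norm_num) hhalf
  have hpos : ∀ ν ≥ ν₀, ∀ y ∈ Set.Ioo (1 / 2 : ℝ) 1, 0 < charFun y ν := fun ν hν y hy =>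
    charFun_pos_of_lt (hν₀.1.trans_le hν) le_rfl hy.1 hy.2
      (hz ▸ hmono.monotoneOn hν₀.1 (hν₀.1.trans_le hν) hν)
  have hex : ∀ ν ∈ Set.Ioo 0 ν₀, ∃ y ∈ Set.Ioo (1 / 2 : ℝ) 1, charFun y ν = 0 := fun ν hν =>
    exists_charFun_eq_zero_right hν.1 (hz ▸ hmono hν.1 hν₀.1 hν.2)
  choose! Y hYmem hY0 using hex
  have hanti : StrictAntiOn Y (Set.Ioo 0 ν₀) := by
    intro ν₁ h₁ ν₂ h₂ h
    have h3 : 0 < charFun (Y ν₁) ν₂ := by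
      rw [← hY0 ν₁ h₁]
      exact charFun_strictMonoOn (by linarith [(hYmem ν₁ h₁).1]) (hYmem ν₁ h₁).2 h₁.1 h₂.1 h
    by_contra! h4
    refine ne_of_gt ?_ (hY0 ν₂ h₂)
    rcases h4.eq_or_lt with h5 | h5
    · rwa [← h5]
    · exact charFun_pos_of_lt h₂.1 (hYmem ν₁ h₁).1.le h5 (hYmem ν₂ h₂).2 h3.le
  have himage : Y '' Set.Ioo 0 ν₀ = Set.Ioo (1 / 2 : ℝ) 1 := by
    -- For surjectivity, fix y and vary ν: `charFun y` is negative near 0 and positive at ν₀, so it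
    -- vanishes at some ν, and uniqueness gives Y ν = y.
    refine Set.Subset.antisymm (Set.image_subset_iff.2 hYmem) fun y hy => ?_
    obtain ⟨ν, hν, h0⟩ := exists_charFun_eq_zero_left hy.1.le hy.2 hν₀.1 (hpos ν₀ le_rfl y hy)
    exact ⟨ν, hν, charFun_zero_unique hν.1 (hYmem ν hν) hy (hY0 ν hν) h0⟩
  -- A strictly monotone function with open image is continuous; passing to -Y makes it increasing.
  have hcont : ∀ ν ∈ Set.Ioo 0 ν₀, ContinuousAt Y ν := fun ν hν => by
    have h1 : ContinuousAt (fun s => -Y s) ν := by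
      refine StrictMonoOn.continuousAt_of_image_mem_nhds (s := Set.Ioo 0 ν₀)
        (fun a ha b hb hab => neg_lt_neg (hanti ha hb hab)) (isOpen_Ioo.mem_nhds hν) ?_
      have h2 : (fun s => -Y s) '' Set.Ioo 0 ν₀ = Set.Ioo (-1) (-(1 / 2)) := by
        rw [← Set.image_image Neg.neg Y, himage, Set.image_neg_eq_neg, Set.neg_Ioo]
      rw [h2]
      exact isOpen_Ioo.mem_nhds ⟨neg_lt_neg (hYmem ν hν).2, neg_lt_neg (hYmem ν hν).1⟩
    exact h1.neg.congr (Filter.Eventually.of_forall fun s => neg_neg (Y s))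
  refine ⟨ν₀, hν₀, fun ν hν => ?_, fun ν hν => ?_, fun ν => Y ν - 1 / 2, fun ν hν => ?_,
    fun ν hν => ?_, fun a ha b hb hab => sub_lt_sub_right (hanti ha hb hab) _, ?_⟩
  · rw [hyp3F2_eq_charFun_half]
    exact ⟨fun h => hmono.injOn hν hν₀.1 (h.trans hz.symm), fun h => h ▸ hz⟩
  · refine Set.eq_empty_of_forall_notMem fun μ hμ => ?_
    obtain ⟨y, hy, h0, -⟩ := (mem_pointSpectrum_J_iff (hν₀.1.trans_le hν)).1 hμ
    exact (hpos ν hν y hy).ne' h0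
  · have hYν := hYmem ν hν
    refine ⟨⟨by linarith [hYν.1], by linarith [hYν.2]⟩, fun x hx => ?_, ?_⟩
    · rw [hyp3F2_eq_charFun]
      refine ⟨fun h => ?_, fun h => ?_⟩
      · change x = Y ν - 1 / 2
        rw [charFun_zero_unique hν.1 hYν ⟨by linarith [hx.1], by linarith [hx.2]⟩ (hY0 ν hν) h]
        ring
      · rw [h, sub_add_cancel]
        exact hY0 ν hν
    · have hval : 1 / 4 - (Y ν - 1 / 2) ^ 2 = Y ν * (1 - Y ν) := by ring
      ext μ
      rw [mem_pointSpectrum_J_iff hν.1, Set.mem_singleton_iff, hval]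
      constructor
      · rintro ⟨y, hy, h0, rfl⟩
        rw [charFun_zero_unique hν.1 hYν hy (hY0 ν hν) h0]
      · rintro rfl
        exact ⟨Y ν, hYν, hY0 ν hν, rfl⟩
  · refine AnalyticAt.sub (analyticAt_of_charFun_eq_zero hν.1 (hcont ν hν) (hYmem ν hν) ?_)
      analyticAt_const
    filter_upwards [isOpen_Ioo.mem_nhds hν] with s hs
    exact hY0 s hs
  · rw [← Set.image_image (fun y => y - 1 / 2) Y, himage, Set.image_sub_const_Ioo]
    norm_num
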